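/- Let $K$ be a field. All vector spaces are $\mathbb Z$-graded over $K$, and the Koszul sign rule is used throughout. A unital coalgebra is a counital coassociative coalgebra $(C,\Delta,\varepsilon)$, with structure maps of degree $0$, together with a group-like element $1\in C_0$. The tensor coalgebra on $V$ is $T^c(V)=\bigoplus_{k\ge 0}V^{\otimes k}$ with the deconcatenation comultiplication, with the projection to $V^{\otimes 0}=K$ as counit and with $1\in V^{\otimes 0}$ as unit. A unital coalgebra $C$ is *cofree* if it is isomorphic to some $T^c(V)$. It is *conilpotent* if for each $x\in\bar C=\ker\varepsilon$ there is $r$ with $\bar\Delta^{(r)}(x)=0$, where $\bar\Delta^{(r)}:\bar C\to\bar C^{\otimes (r+1)}$ is the $r$-fold iteration of $\bar\Delta(x)=\Delta(x)-x\otimes 1-1\otimes x$. A *$B_\infty$ algebra* is a graded vector space $A$ together with a product $\mu$ and a differential $d$ of degree $-1$ on $T^c(A)$ that make $T^c(A)$, with its given coalgebra structure and unit, a differential graded bialgebra. A homomorphism $A\to B$ is a linear map $f$ of degree $0$ such that $T^c(f)$ commutes with the products and the differentials. A *2-associative differential bialgebra* is a unital coalgebra $(V,\Delta,\varepsilon,1)$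 with a differential $\partial$ of degree $-1$ and two associative products $\bullet$ and $\circ$ of degree $0$, both with unit $1$, such that $(V,\partial,\bullet,\Delta)$ is a differential graded bialgebra and $(V,\circ,\Delta)$ is a unital infinitesimal bialgebra, that is, $\Delta(x\circ y)=x_{(1)}\otimes (x_{(2)}\circ y)+(x\circ y_{(1)})\otimes y_{(2)}-x\otimes y$. Homomorphisms are the linear maps of degree $0$ that preserve all of the structure. Such a bialgebra is termed conilpotent or cofree if its underlying unital coalgebra is. The following three categories are equivalent: $B_\infty$ algebras, conilpotent 2-associative differential bialgebras, and cofree 2-associative differential bialgebras (the last two as full subcategories of all 2-associative differential bialgebras). More precisely, let $U$ be the functor that sends a $B_\infty$ algebra $(A,\mu,d)$ to the 2-associative differential bialgebra $T^c(A)$ with $\partial=d$, $\bullet=\mu$, with concatenation of tensors as $\circ$ and with the deconcatenation comultiplication, and sends $f$ to $T^c(f)$. Then $U$ takes values in the conilpotent and in the cofree objects and is an equivalence onto each of these two full subcategories. Moreover, every conilpotent 2-associative differential bialgebra is cofree, and the resulting inclusion of the full subcategory of conilpotent objects in that of cofree objects is an equivalence. -/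

import Mathlib

open CategoryTheory
open scoped TensorProduct DirectSum

universe w w₁ w₂ u v

noncomputable section

namespace BInfinity

/-! ### Graded vector spaces and Koszul signs -/

/-- A `ℤ`-graded vector space over `K`, given as a vector space with a direct sum decomposition into
its homogeneous components `deg n`, `n ∈ ℤ`. -/
structure GradedSpace (K : Type u) [Field K] where
  carrier : Type w
  [addCommGroup : AddCommGroup carrier]
  [module : Module K carrier]
  deg : ℤ → Submodule K carrier
  [decomposition : DirectSum.Decomposition deg]

attribute [instance] GradedSpace.addCommGroup GradedSpace.module GradedSpace.decomposition

instance (K : Type u) [Field K] : CoeSort (GradedSpace.{w} K) (Type w) := ⟨GradedSpace.carrier⟩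

section Graded

variable {K : Type u} [Field K]

/-- A linear map `f` is of degree `k` if it sends the component of degree `n` to the component of
degree `n + k`. -/
def HasDegree (V : GradedSpace.{w₁} K) (W : GradedSpace.{w₂} K) (k : ℤ) (f : V →ₗ[K] W) : Prop :=
  ∀ n : ℤ, ∀ x ∈ V.deg n, f x ∈ W.deg (n + k)

/-- The component of degree `n` of `V ⊗ W`: it is spanned by the `x ⊗ y` with `|x| + |y| = n`. -/
def tensorDeg (V : GradedSpace.{w₁} K) (W : GradedSpace.{w₂} K) (n : ℤ) :
    Submodule K (V ⊗[K] W) :=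
  Submodule.span K {t | ∃ i j : ℤ, i + j = n ∧ ∃ x ∈ V.deg i, ∃ y ∈ W.deg j, t = x ⊗ₜ[K] y}

/-- The projection of a graded vector space onto the sum of its components of odd degree. -/
def oddPart (V : GradedSpace.{w} K) : V →ₗ[K] V :=
  DirectSum.toModule K ℤ V (fun i => if Odd i then (V.deg i).subtype else 0) ∘ₗ
    (DirectSum.decomposeLinearEquiv V.deg).toLinearMap

/-- The linear map `x ↦ (-1)^|x| x`. -/
def signMap (V : GradedSpace.{w} K) : V →ₗ[K] V :=
  LinearMap.id - (2 : K) • oddPart V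

/-- The symmetry `(23) : (A ⊗ B) ⊗ (C ⊗ D) → (A ⊗ C) ⊗ (B ⊗ D)` with its Koszul sign,
`(a ⊗ b) ⊗ (c ⊗ d) ↦ (-1)^(|b||c|) (a ⊗ c) ⊗ (b ⊗ d)`. The sign is `-1` exactly when `b` and `c`
are both of odd degree. -/
def middleSwap (A B C D : GradedSpace.{w} K) :
    (A ⊗[K] B) ⊗[K] (C ⊗[K] D) →ₗ[K] (A ⊗[K] C) ⊗[K] (B ⊗[K] D) :=
  (TensorProduct.tensorTensorTensorComm K A B C D).toLinearMap ∘ₗ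
    (LinearMap.id - (2 : K) • TensorProduct.map
      (TensorProduct.map LinearMap.id (oddPart B)) (TensorProduct.map (oddPart C) LinearMap.id))

theorem oddPart_apply (V : GradedSpace.{w} K) {i : ℤ} {x : V} (hx : x ∈ V.deg i) :
    oddPart V x = if Odd i then x else 0 := by
  have h := DirectSum.decompose_of_mem V.deg hx
  simp only [oddPart, LinearMap.comp_apply, LinearEquiv.coe_coe,
    DirectSum.decomposeLinearEquiv_apply]
  rw [h, ← DirectSum.lof_eq_of K, DirectSum.toModule_lof]
  split_ifs <;> simp

theorem signMap_apply (V : GradedSpace.{w} K) {i : ℤ} {x : V} (hx : x ∈ V.deg i) :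
    signMap V x = ((Int.negOnePow i : ℤ) : K) • x := by
  rw [signMap, LinearMap.sub_apply, LinearMap.smul_apply, oddPart_apply V hx]
  rcases Int.even_or_odd i with h | h
  · simp [Int.negOnePow_even i h, Int.not_odd_iff_even.2 h]
  · simp only [Int.negOnePow_odd i h, h, if_true, LinearMap.id_apply]
    push_cast
    module

theorem middleSwap_apply (A B C D : GradedSpace.{w} K) {i j : ℤ} (a : A) {b : B} {c : C} (d : D)
    (hb : b ∈ B.deg i) (hc : c ∈ C.deg j) :
    middleSwap A B C D ((a ⊗ₜ[K] b) ⊗ₜ[K] (c ⊗ₜ[K] d)) =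
      ((Int.negOnePow (i * j) : ℤ) : K) • ((a ⊗ₜ[K] c) ⊗ₜ[K] (b ⊗ₜ[K] d)) := by
  simp only [middleSwap, LinearMap.comp_apply, LinearMap.sub_apply, LinearMap.smul_apply,
    TensorProduct.map_tmul, LinearMap.id_apply, oddPart_apply B hb, oddPart_apply C hc, map_sub,
    map_smul, LinearEquiv.coe_coe]
  by_cases h : Odd i ∧ Odd j
  · rw [if_pos h.1, if_pos h.2, Int.negOnePow_odd _ (Int.odd_mul.2 h)]
    simp only [TensorProduct.tensorTensorTensorComm_tmul]
    push_cast
    module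
  · have h' : Even (i * j) := by
      rw [← Int.not_odd_iff_even, Int.odd_mul]; exact h
    rw [Int.negOnePow_even _ h']
    rcases not_and_or.1 h with h | h <;> simp [h]

end Graded

/-! ### Unital coalgebras -/

/-- A unital (coaugmented) graded coalgebra: a coassociative counital coalgebra whose structure maps
have degree zero, with a group-like element `one`. -/
structure UnitalCoalgebra (K : Type u) [Field K] extends GradedSpace.{w} K where
  [coalgebra : Coalgebra K carrier]
  one : carrier
  comul_mem : ∀ n : ℤ, ∀ x ∈ deg n,
    Coalgebra.comul (R := K) x ∈ tensorDeg toGradedSpace toGradedSpace n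
  counit_eq_zero : ∀ n : ℤ, n ≠ 0 → ∀ x ∈ deg n, Coalgebra.counit (R := K) x = 0
  one_mem : one ∈ deg 0
  comul_one : Coalgebra.comul (R := K) one = one ⊗ₜ[K] one
  counit_one : Coalgebra.counit (R := K) one = 1

attribute [instance] UnitalCoalgebra.coalgebra

instance (K : Type u) [Field K] : CoeSort (UnitalCoalgebra.{w} K) (Type w) :=
  ⟨fun C => C.toGradedSpace.carrier⟩

section Coalgebra

variable {K : Type u} [Field K]

/-- `f` is a map of unital graded coalgebras. -/
structure IsUnitalCoalgebraMap (C : UnitalCoalgebra.{w₁} K) (D : UnitalCoalgebra.{w₂} K)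
    (f : C →ₗ[K] D) : Prop where
  degree : HasDegree C.toGradedSpace D.toGradedSpace 0 f
  comul : Coalgebra.comul ∘ₗ f = TensorProduct.map f f ∘ₗ Coalgebra.comul
  counit : Coalgebra.counit ∘ₗ f = Coalgebra.counit (R := K)
  one : f C.one = D.one

/-- The projection `J = id - η ε` of `C` onto the kernel of the counit. -/
def reducedProj (C : UnitalCoalgebra.{w} K) : C →ₗ[K] C :=
  LinearMap.id - (Coalgebra.counit (R := K)).smulRight C.one

/-- The reduced comultiplication `J^{⊗2} Δ`, which on the kernel of the counit is
`Δ(x) - x ⊗ 1 - 1 ⊗ x`. -/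
def reducedComul (C : UnitalCoalgebra.{w} K) : C →ₗ[K] C ⊗[K] C :=
  TensorProduct.map (reducedProj C) (reducedProj C) ∘ₗ Coalgebra.comul

/-- The `r`-fold iteration of the reduced comultiplication, with values in `C^{⊗(r+1)}`, seen as the
space of tensors of length `r + 1` in the tensor algebra on the vector space `C`. -/
def iteratedReducedComul (C : UnitalCoalgebra.{w} K) : ℕ → C →ₗ[K] TensorAlgebra K C
  | 0 => TensorAlgebra.ι K
  | r + 1 => LinearMap.mul' K (TensorAlgebra K C) ∘ₗ
      TensorProduct.map (TensorAlgebra.ι K) (iteratedReducedComul C r) ∘ₗ reducedComul C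

/-- A unital coalgebra is conilpotent if each element of the kernel of the counit is killed by some
iteration of the reduced comultiplication. -/
def UnitalCoalgebra.IsConilpotent (C : UnitalCoalgebra.{w} K) : Prop :=
  ∀ x : C, Coalgebra.counit (R := K) x = 0 → ∃ r : ℕ, iteratedReducedComul C r x = 0

theorem reducedComul_apply (C : UnitalCoalgebra.{w} K) (x : C)
    (hx : Coalgebra.counit (R := K) x = 0) :
    reducedComul C x = Coalgebra.comul (R := K) x - x ⊗ₜ[K] C.one - C.one ⊗ₜ[K] x := by
  have h1 := Coalgebra.rTensor_counit_comul (R := K) x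
  have h2 := Coalgebra.lTensor_counit_comul (R := K) x
  have key : ∀ t : C ⊗[K] C,
      TensorProduct.map (reducedProj C) (reducedProj C) t =
        t - C.one ⊗ₜ[K] (TensorProduct.lid K C ((Coalgebra.counit (R := K)).rTensor C t))
          - (TensorProduct.rid K C ((Coalgebra.counit (R := K)).lTensor C t)) ⊗ₜ[K] C.one
          + (Coalgebra.counit (R := K)
              (TensorProduct.lid K C ((Coalgebra.counit (R := K)).rTensor C t))) •
            (C.one ⊗ₜ[K] C.one) := by
    intro t
    induction t with
    | zero => simp
    | add a b ha hb =>
      simp only [map_add, ha, hb, TensorProduct.tmul_add, TensorProduct.add_tmul, add_smul]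
      abel
    | tmul a b =>
      simp only [reducedProj, TensorProduct.map_tmul, LinearMap.sub_apply, LinearMap.id_apply,
        LinearMap.smulRight_apply, LinearMap.rTensor_tmul, LinearMap.lTensor_tmul,
        TensorProduct.lid_tmul, TensorProduct.rid_tmul, TensorProduct.sub_tmul,
        TensorProduct.tmul_sub, TensorProduct.tmul_smul, ← TensorProduct.smul_tmul', map_smul,
        smul_eq_mul]
      module
  rw [reducedComul, LinearMap.comp_apply, key, h1, h2]
  simp only [TensorProduct.lid_tmul, TensorProduct.rid_tmul, one_smul, hx, zero_smul]
  abel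

end Coalgebra

/-! ### The tensor coalgebra -/

section TensorCoalgebra

variable {K : Type u} [Field K]

/-- The component of degree `n` of `T(V) = ⨁ V^{⊗k}`: it is spanned by the words `v₁ ⋯ v_k` in
homogeneous elements with `|v₁| + ⋯ + |v_k| = n`. -/
def wordDeg (V : GradedSpace.{w} K) (n : ℤ) : Submodule K (TensorAlgebra K V) :=
  Submodule.span K {t | ∃ l : List (Σ i : ℤ, V.deg i), (l.map fun p => p.1).sum = n ∧
    t = (l.map fun p => TensorAlgebra.ι K (p.2 : V)).prod}

theorem wordDeg_mul (V : GradedSpace.{w} K) {m n : ℤ} {x y : TensorAlgebra K V}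
    (hx : x ∈ wordDeg V m) (hy : y ∈ wordDeg V n) : x * y ∈ wordDeg V (m + n) := by
  have h := Submodule.mul_mem_mul hx hy
  rw [wordDeg, wordDeg, Submodule.span_mul_span] at h
  refine Submodule.span_mono ?_ h
  rintro _ ⟨_, ⟨l, hl, rfl⟩, _, ⟨l', hl', rfl⟩, rfl⟩
  exact ⟨l ++ l', by simp [hl, hl'], by simp⟩

instance wordDeg_gradedMonoid (V : GradedSpace.{w} K) : SetLike.GradedMonoid (wordDeg V) where
  one_mem := Submodule.subset_span ⟨[], by simp, by simp⟩
  mul_mem _ _ _ _ hx hy := wordDeg_mul V hx hy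

theorem ι_mem_wordDeg (V : GradedSpace.{w} K) {n : ℤ} {x : V} (hx : x ∈ V.deg n) :
    TensorAlgebra.ι K x ∈ wordDeg V n :=
  Submodule.subset_span ⟨[⟨n, x, hx⟩], by simp, by simp⟩

/-- The map `V → ⨁ n, T(V)_n`, used to show that the `T(V)_n` decompose `T(V)`. -/
def wordDecomposeι (V : GradedSpace.{w} K) : V →ₗ[K] ⨁ n : ℤ, wordDeg V n :=
  DirectSum.toModule K ℤ _ (fun i => DirectSum.lof K ℤ (fun n => wordDeg V n) i ∘ₗ
      ((TensorAlgebra.ι K ∘ₗ (V.deg i).subtype).codRestrict (wordDeg V i)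
        fun x => ι_mem_wordDeg V x.2)) ∘ₗ
    (DirectSum.decomposeLinearEquiv V.deg).toLinearMap

theorem wordDecomposeι_apply (V : GradedSpace.{w} K) {n : ℤ} (x : V.deg n) :
    wordDecomposeι V x =
      DirectSum.of (fun n => wordDeg V n) n ⟨TensorAlgebra.ι K (x : V), ι_mem_wordDeg V x.2⟩ := by
  simp only [wordDecomposeι, LinearMap.comp_apply, LinearEquiv.coe_coe,
    DirectSum.decomposeLinearEquiv_apply_coe]
  rw [← DirectSum.lof_eq_of K, DirectSum.toModule_lof]
  rfl

instance wordDeg_gradedAlgebra (V : GradedSpace.{w} K) : GradedAlgebra (wordDeg V) :=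
  GradedAlgebra.ofAlgHom _ (TensorAlgebra.lift K (wordDecomposeι V))
    (by
      refine TensorAlgebra.hom_ext (DirectSum.decompose_lhom_ext V.deg fun i => ?_)
      ext x
      simp only [LinearMap.comp_apply, AlgHom.toLinearMap_apply, AlgHom.comp_apply,
        AlgHom.id_apply, TensorAlgebra.lift_ι_apply, Submodule.subtype_apply]
      rw [wordDecomposeι_apply, DirectSum.coeAlgHom_of])
    (by
      rintro n ⟨x, hx⟩
      dsimp only
      induction hx using Submodule.span_induction with
      | mem x h =>
        obtain ⟨l, hl, rfl⟩ := h
        induction l generalizing n with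
        | nil =>
          simp only [List.map_nil, List.prod_nil, List.sum_nil, map_one] at hl ⊢
          subst hl
          rfl
        | cons p l ih =>
          simp only [List.map_cons, List.prod_cons, List.sum_cons, map_mul,
            TensorAlgebra.lift_ι_apply] at hl ⊢
          rw [ih _ rfl, wordDecomposeι_apply, DirectSum.of_mul_of]
          exact DirectSum.of_eq_of_gradedMonoid_eq (Sigma.subtype_ext hl rfl)
      | zero => rw [map_zero]; exact (map_zero (DirectSum.of (fun n => wordDeg V n) n)).symm
      | add x y hx hy ihx ihy =>
        rw [map_add, ihx, ihy, ← map_add]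
        rfl
      | smul a x hx ih =>
        rw [map_smul, ih, ← DirectSum.lof_eq_of K, ← map_smul]
        rfl)

/-- The tensor algebra `T(V) = ⨁ V^{⊗k}` as a graded vector space. -/
abbrev tensorSpace (V : GradedSpace.{w} K) : GradedSpace.{max u w} K where
  carrier := TensorAlgebra K V
  deg := wordDeg V

/-- Induction on words. -/
theorem word_induction {V : Type w} [AddCommGroup V] [Module K V] {P : TensorAlgebra K V → Prop}
    (one : P 1) (cons : ∀ (v : V) x, P x → P (TensorAlgebra.ι K v * x))
    (add : ∀ x y, P x → P y → P (x + y)) (smul : ∀ (a : K) x, P x → P (a • x))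
    (x : TensorAlgebra K V) : P x := by
  suffices h : ∀ x y : TensorAlgebra K V, P y → P (x * y) by simpa using h x 1 one
  intro x
  induction x using TensorAlgebra.induction with
  | algebraMap r => intro y hy; rw [← Algebra.smul_def]; exact smul r y hy
  | ι v => exact fun y hy => cons v y hy
  | mul a b ha hb => intro y hy; rw [mul_assoc]; exact ha _ (hb _ hy)
  | add a b ha hb => intro y hy; rw [add_mul]; exact add _ _ (ha _ hy) (hb _ hy)

/-- Prefixing a letter `v` to a word `x` whose deconcatenation is `D`:
`(D, x) ↦ ((v ⊗ 1) D + 1 ⊗ v x, v x)`. -/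
def deconcStep (V : Type w) [AddCommGroup V] [Module K V] :
    V →ₗ[K] Module.End K ((TensorAlgebra K V ⊗[K] TensorAlgebra K V) × TensorAlgebra K V) :=
  LinearMap.mk₂ K
    (fun v p => ((TensorAlgebra.ι K v ⊗ₜ[K] 1) * p.1 + 1 ⊗ₜ[K] (TensorAlgebra.ι K v * p.2),
      TensorAlgebra.ι K v * p.2))
    (fun a b p => by
      simp only [map_add, TensorProduct.add_tmul, add_mul, TensorProduct.tmul_add, Prod.mk_add_mk]
      congr 1; abel)
    (fun c a p => by
      simp only [map_smul, smul_mul_assoc, TensorProduct.tmul_smul, Prod.smul_mk, smul_add,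
        ← TensorProduct.smul_tmul'])
    (fun a p q => by
      simp only [Prod.fst_add, Prod.snd_add, mul_add, TensorProduct.tmul_add, Prod.mk_add_mk]
      congr 1; abel)
    (fun c a p => by
      simp only [Prod.smul_fst, Prod.smul_snd, mul_smul_comm, TensorProduct.tmul_smul,
        Prod.smul_mk, smul_add])

/-- Deconcatenation, `Δ(v₁ ⋯ v_k) = ∑ i, v₁ ⋯ v_i ⊗ v_{i+1} ⋯ v_k`, defined letter by letter;
see `deconc_word` for the closed formula. -/
def deconc (V : Type w) [AddCommGroup V] [Module K V] :
    TensorAlgebra K V →ₗ[K] TensorAlgebra K V ⊗[K] TensorAlgebra K V :=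
  LinearMap.fst K _ _ ∘ₗ LinearMap.applyₗ (1 ⊗ₜ[K] 1, 1) ∘ₗ
    (TensorAlgebra.lift K (deconcStep V)).toLinearMap

section Deconc

variable {V : Type w} [AddCommGroup V] [Module K V]

theorem deconc_one : deconc V (1 : TensorAlgebra K V) = 1 ⊗ₜ[K] 1 := by
  simp [deconc]

theorem deconcStep_apply (v : V)
    (p : (TensorAlgebra K V ⊗[K] TensorAlgebra K V) × TensorAlgebra K V) :
    deconcStep V v p = ((TensorAlgebra.ι K v ⊗ₜ[K] 1) * p.1 + 1 ⊗ₜ[K] (TensorAlgebra.ι K v * p.2),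
      TensorAlgebra.ι K v * p.2) := rfl

theorem deconcStep_snd (x : TensorAlgebra K V) :
    (TensorAlgebra.lift K (deconcStep V) x (1 ⊗ₜ[K] 1, 1)).2 = x := by
  induction x using word_induction with
  | one => simp
  | cons v x hx =>
    rw [map_mul, TensorAlgebra.lift_ι_apply, Module.End.mul_apply]
    rw [deconcStep_apply, hx]
  | add x y hx hy => simp [hx, hy]
  | smul a x hx => simp [hx]

theorem deconc_ι_mul (v : V) (x : TensorAlgebra K V) :
    deconc V (TensorAlgebra.ι K v * x) =
      (TensorAlgebra.ι K v ⊗ₜ[K] 1) * deconc V x + 1 ⊗ₜ[K] (TensorAlgebra.ι K v * x) := by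
  simp only [deconc, LinearMap.comp_apply, AlgHom.toLinearMap_apply, map_mul,
    TensorAlgebra.lift_ι_apply, LinearMap.applyₗ_apply_apply, Module.End.mul_apply]
  rw [deconcStep_apply, deconcStep_snd]
  rfl

theorem deconc_word (l : List V) :
    deconc V (l.map (TensorAlgebra.ι K)).prod =
      ∑ i ∈ Finset.range (l.length + 1),
        ((l.take i).map (TensorAlgebra.ι K)).prod ⊗ₜ[K]
          ((l.drop i).map (TensorAlgebra.ι K)).prod := by
  induction l with
  | nil => simp [deconc_one]
  | cons v l ih =>
    rw [List.map_cons, List.prod_cons, deconc_ι_mul, ih, List.length_cons,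
      Finset.sum_range_succ' _ (l.length + 1), Finset.mul_sum]
    simp [Algebra.TensorProduct.tmul_mul_tmul]

theorem deconc_mul (x y : TensorAlgebra K V) :
    deconc V (x * y) = deconc V x * (1 ⊗ₜ[K] y) + (x ⊗ₜ[K] 1) * deconc V y - x ⊗ₜ[K] y := by
  induction x using word_induction with
  | one =>
    simp only [one_mul, deconc_one, Algebra.TensorProduct.tmul_mul_tmul, mul_one]
    rw [← Algebra.TensorProduct.one_def, one_mul]; abel
  | cons v x hx =>
    rw [mul_assoc, deconc_ι_mul, hx, deconc_ι_mul]
    simp only [mul_add, add_mul, mul_sub, ← mul_assoc, Algebra.TensorProduct.tmul_mul_tmul,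
      one_mul, mul_one]
    abel
  | add a b ha hb =>
    simp only [add_mul, map_add, ha, hb, TensorProduct.add_tmul]
    abel
  | smul c a ha =>
    simp only [smul_mul_assoc, map_smul, ha, ← TensorProduct.smul_tmul', smul_add, smul_sub]

theorem deconc_mul' (x y : TensorAlgebra K V) :
    deconc V (x * y) =
      TensorProduct.map LinearMap.id ((LinearMap.mul K (TensorAlgebra K V)).flip y) (deconc V x) +
      TensorProduct.map (LinearMap.mul K (TensorAlgebra K V) x) LinearMap.id (deconc V y) -
      x ⊗ₜ[K] y := by
  have h1 : ∀ t : TensorAlgebra K V ⊗[K] TensorAlgebra K V, t * (1 ⊗ₜ[K] y) =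
      TensorProduct.map LinearMap.id ((LinearMap.mul K (TensorAlgebra K V)).flip y) t := by
    intro t
    induction t with
    | zero => simp
    | add a b ha hb => simp only [add_mul, map_add, ha, hb]
    | tmul a b => simp [Algebra.TensorProduct.tmul_mul_tmul]
  have h2 : ∀ t : TensorAlgebra K V ⊗[K] TensorAlgebra K V, (x ⊗ₜ[K] 1) * t =
      TensorProduct.map (LinearMap.mul K (TensorAlgebra K V) x) LinearMap.id t := by
    intro t
    induction t with
    | zero => simp
    | add a b ha hb => simp only [mul_add, map_add, ha, hb]
    | tmul a b => simp [Algebra.TensorProduct.tmul_mul_tmul]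
  rw [deconc_mul, h1, h2]

/-- The counit of the tensor coalgebra: the projection of `T(V)` onto `V^{⊗0} = K`. -/
def wordCounit (V : Type w) [AddCommGroup V] [Module K V] : TensorAlgebra K V →ₗ[K] K :=
  TensorAlgebra.algebraMapInv.toLinearMap

theorem wordCounit_one : wordCounit V (1 : TensorAlgebra K V) = 1 := by
  simp [wordCounit]

theorem wordCounit_ι_mul (v : V) (x : TensorAlgebra K V) :
    wordCounit V (TensorAlgebra.ι K v * x) = 0 := by
  simp [wordCounit, TensorAlgebra.algebraMapInv]

theorem deconc_coassoc (x : TensorAlgebra K V) :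
    TensorProduct.assoc K _ _ _ ((deconc (K := K) V).rTensor _ (deconc V x)) =
      (deconc (K := K) V).lTensor _ (deconc V x) := by
  induction x using word_induction with
  | one => simp [deconc_one]
  | cons v x hx =>
    have h1 : ∀ t : TensorAlgebra K V ⊗[K] TensorAlgebra K V,
        TensorProduct.assoc K _ _ _
          ((deconc (K := K) V).rTensor _ ((TensorAlgebra.ι K v ⊗ₜ[K] 1) * t)) =
        (TensorAlgebra.ι K v ⊗ₜ[K] (1 ⊗ₜ[K] 1)) *
          TensorProduct.assoc K _ _ _ ((deconc (K := K) V).rTensor _ t) +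
        1 ⊗ₜ[K] ((TensorAlgebra.ι K v ⊗ₜ[K] 1) * t) := by
      intro t
      induction t with
      | zero => simp
      | add a b ha hb =>
        simp only [mul_add, map_add, ha, hb, TensorProduct.tmul_add]; abel
      | tmul a b =>
        simp only [Algebra.TensorProduct.tmul_mul_tmul, LinearMap.rTensor_tmul, one_mul,
          deconc_ι_mul, TensorProduct.add_tmul, map_add, TensorProduct.assoc_tmul]
        congr 1
        generalize deconc (K := K) V a = s
        induction s with
        | zero => simp
        | add p q hp hq => simp only [mul_add, map_add, TensorProduct.add_tmul, hp, hq]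
        | tmul p q => simp [Algebra.TensorProduct.tmul_mul_tmul]
    have h2 : ∀ t : TensorAlgebra K V ⊗[K] TensorAlgebra K V,
        (deconc (K := K) V).lTensor _ ((TensorAlgebra.ι K v ⊗ₜ[K] 1) * t) =
        (TensorAlgebra.ι K v ⊗ₜ[K] (1 ⊗ₜ[K] 1)) * (deconc (K := K) V).lTensor _ t := by
      intro t
      induction t with
      | zero => simp
      | add a b ha hb => simp only [mul_add, map_add, ha, hb]
      | tmul a b =>
        simp only [Algebra.TensorProduct.tmul_mul_tmul, LinearMap.lTensor_tmul, one_mul]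
        rw [← Algebra.TensorProduct.one_def, one_mul]
    rw [deconc_ι_mul, map_add, map_add, map_add, h1, h2, hx]
    simp only [LinearMap.rTensor_tmul, LinearMap.lTensor_tmul, deconc_one, deconc_ι_mul,
      TensorProduct.assoc_tmul, TensorProduct.tmul_add]
    abel
  | add a b ha hb => simp only [map_add, ha, hb]
  | smul c a ha => simp only [map_smul, ha]

theorem rTensor_wordCounit_deconc (x : TensorAlgebra K V) :
    (wordCounit (K := K) V).rTensor _ (deconc V x) = 1 ⊗ₜ[K] x := by
  induction x using word_induction with
  | one => simp [deconc_one, wordCounit_one]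
  | cons v x hx =>
    have h1 : ∀ t : TensorAlgebra K V ⊗[K] TensorAlgebra K V,
        (wordCounit (K := K) V).rTensor (TensorAlgebra K V)
          ((TensorAlgebra.ι K v ⊗ₜ[K] 1) * t) = 0 := by
      intro t
      induction t with
      | zero => simp
      | add a b ha hb => simp only [mul_add, map_add, ha, hb, add_zero]
      | tmul a b =>
        rw [Algebra.TensorProduct.tmul_mul_tmul, LinearMap.rTensor_tmul, wordCounit_ι_mul,
          TensorProduct.zero_tmul]
    rw [deconc_ι_mul, map_add, h1, LinearMap.rTensor_tmul, wordCounit_one, zero_add]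
  | add a b ha hb => simp only [map_add, ha, hb, TensorProduct.tmul_add]
  | smul c a ha => simp only [map_smul, ha, TensorProduct.tmul_smul]

theorem lTensor_wordCounit_deconc (x : TensorAlgebra K V) :
    (wordCounit (K := K) V).lTensor _ (deconc V x) = x ⊗ₜ[K] 1 := by
  induction x using word_induction with
  | one => simp [deconc_one, wordCounit_one]
  | cons v x hx =>
    have h1 : ∀ t : TensorAlgebra K V ⊗[K] TensorAlgebra K V,
        (wordCounit (K := K) V).lTensor (TensorAlgebra K V)
          ((TensorAlgebra.ι K v ⊗ₜ[K] 1) * t) =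
        (TensorAlgebra.ι K v ⊗ₜ[K] 1) * (wordCounit (K := K) V).lTensor _ t := by
      intro t
      induction t with
      | zero => simp
      | add a b ha hb => simp only [mul_add, map_add, ha, hb]
      | tmul a b => simp [Algebra.TensorProduct.tmul_mul_tmul]
    rw [deconc_ι_mul, map_add, h1, hx, LinearMap.lTensor_tmul, wordCounit_ι_mul,
      Algebra.TensorProduct.tmul_mul_tmul, mul_one, TensorProduct.tmul_zero, add_zero]
  | add a b ha hb => simp only [map_add, ha, hb, TensorProduct.add_tmul]
  | smul c a ha => simp only [map_smul, ha, TensorProduct.smul_tmul']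

end Deconc

/-- The deconcatenation coalgebra structure on `T(V)`. -/
@[reducible]
def deconcCoalgebra (V : Type w) [AddCommGroup V] [Module K V] :
    Coalgebra K (TensorAlgebra K V) where
  comul := deconc V
  counit := wordCounit V
  coassoc := LinearMap.ext deconc_coassoc
  rTensor_counit_comp_comul := LinearMap.ext rTensor_wordCounit_deconc
  lTensor_counit_comp_comul := LinearMap.ext lTensor_wordCounit_deconc

theorem deconc_mem (V : GradedSpace.{w} K) (n : ℤ) (x : TensorAlgebra K V) (hx : x ∈ wordDeg V n) :
    deconc V x ∈ tensorDeg (tensorSpace V) (tensorSpace V) n := by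
  induction hx using Submodule.span_induction with
  | mem x h =>
    obtain ⟨l, hl, rfl⟩ := h
    have h := deconc_word (K := K) (l.map fun p => (p.2 : V))
    simp only [List.map_map, ← List.map_take, ← List.map_drop] at h
    change deconc V (l.map (TensorAlgebra.ι K ∘ fun p => (p.2 : V))).prod ∈ _
    rw [h]
    refine Submodule.sum_mem _ fun i _ => Submodule.subset_span ?_
    refine ⟨_, _, ?_, _, Submodule.subset_span ⟨l.take i, rfl, rfl⟩, _,
      Submodule.subset_span ⟨l.drop i, rfl, rfl⟩, rfl⟩
    rw [← List.sum_append, ← List.map_append, List.take_append_drop, hl]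
  | zero => rw [map_zero]; exact Submodule.zero_mem _
  | add x y _ _ hx hy => rw [map_add]; exact Submodule.add_mem _ hx hy
  | smul a x _ hx => rw [map_smul]; exact Submodule.smul_mem _ _ hx

theorem wordCounit_eq_zero (V : GradedSpace.{w} K) (n : ℤ) (hn : n ≠ 0) (x : TensorAlgebra K V)
    (hx : x ∈ wordDeg V n) : wordCounit V x = 0 := by
  induction hx using Submodule.span_induction with
  | mem x h =>
    obtain ⟨l, hl, rfl⟩ := h
    cases l with
    | nil => exact absurd hl.symm hn
    | cons p l => rw [List.map_cons, List.prod_cons, wordCounit_ι_mul]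
  | zero => simp
  | add x y _ _ hx hy => rw [map_add, hx, hy, add_zero]
  | smul a x _ hx => rw [map_smul, hx, smul_zero]

theorem lift_mem_wordDeg {V W : GradedSpace.{w} K} (f : V →ₗ[K] W) (hf : HasDegree V W 0 f)
    (n : ℤ) (x : TensorAlgebra K V) (hx : x ∈ wordDeg V n) :
    TensorAlgebra.lift K (TensorAlgebra.ι K ∘ₗ f) x ∈ wordDeg W n := by
  induction hx using Submodule.span_induction with
  | mem x h =>
    obtain ⟨l, hl, rfl⟩ := h
    refine Submodule.subset_span ⟨l.map fun p => ⟨p.1, f p.2, by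
      simpa using hf p.1 p.2 p.2.2⟩, ?_, ?_⟩
    · rw [← hl, List.map_map]; rfl
    · rw [map_list_prod, List.map_map, List.map_map]
      congr 2
      ext p
      simp
  | zero => rw [map_zero]; exact Submodule.zero_mem _
  | add x y _ _ hx hy => rw [map_add]; exact Submodule.add_mem _ hx hy
  | smul a x _ hx => rw [map_smul]; exact Submodule.smul_mem _ _ hx

theorem deconc_lift {V W : Type w} [AddCommGroup V] [Module K V] [AddCommGroup W] [Module K W]
    (f : V →ₗ[K] W) (x : TensorAlgebra K V) :
    deconc W (TensorAlgebra.lift K (TensorAlgebra.ι K ∘ₗ f) x) =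
      TensorProduct.map (TensorAlgebra.lift K (TensorAlgebra.ι K ∘ₗ f)).toLinearMap
        (TensorAlgebra.lift K (TensorAlgebra.ι K ∘ₗ f)).toLinearMap (deconc V x) := by
  induction x using word_induction with
  | one => simp [deconc_one]
  | cons v x hx =>
    have h : ∀ t : TensorAlgebra K V ⊗[K] TensorAlgebra K V,
        TensorProduct.map (TensorAlgebra.lift K (TensorAlgebra.ι K ∘ₗ f)).toLinearMap
          (TensorAlgebra.lift K (TensorAlgebra.ι K ∘ₗ f)).toLinearMap
          ((TensorAlgebra.ι K v ⊗ₜ[K] 1) * t) =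
        (TensorAlgebra.ι K (f v) ⊗ₜ[K] 1) *
          TensorProduct.map (TensorAlgebra.lift K (TensorAlgebra.ι K ∘ₗ f)).toLinearMap
            (TensorAlgebra.lift K (TensorAlgebra.ι K ∘ₗ f)).toLinearMap t := by
      intro t
      induction t with
      | zero => simp
      | add a b ha hb => simp only [mul_add, map_add, ha, hb]
      | tmul a b => simp [Algebra.TensorProduct.tmul_mul_tmul]
    rw [map_mul, TensorAlgebra.lift_ι_apply, LinearMap.comp_apply, deconc_ι_mul, hx, deconc_ι_mul,
      map_add, h, TensorProduct.map_tmul]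
    simp
  | add a b ha hb => simp only [map_add, ha, hb]
  | smul c a ha => simp only [map_smul, ha]

theorem wordCounit_lift {V W : Type w} [AddCommGroup V] [Module K V] [AddCommGroup W] [Module K W]
    (f : V →ₗ[K] W) (x : TensorAlgebra K V) :
    wordCounit W (TensorAlgebra.lift K (TensorAlgebra.ι K ∘ₗ f) x) = wordCounit V x := by
  induction x using word_induction with
  | one => simp [wordCounit_one]
  | cons v x hx =>
    rw [map_mul, TensorAlgebra.lift_ι_apply, LinearMap.comp_apply, wordCounit_ι_mul,
      wordCounit_ι_mul]
  | add a b ha hb => simp only [map_add, ha, hb]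
  | smul c a ha => simp only [map_smul, ha]

/-- The tensor coalgebra `T^c(V)`, with the empty word as unit. -/
abbrev tensorCoalgebra (V : GradedSpace.{w} K) : UnitalCoalgebra.{max u w} K where
  toGradedSpace := tensorSpace V
  coalgebra := deconcCoalgebra V.carrier
  one := (1 : TensorAlgebra K V)
  comul_mem := deconc_mem V
  counit_eq_zero := wordCounit_eq_zero V
  one_mem := SetLike.GradedOne.one_mem (A := wordDeg V)
  comul_one := deconc_one
  counit_one := wordCounit_one

/-- A unital coalgebra is cofree if it is isomorphic to a tensor coalgebra `T^c(V)`. -/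
def UnitalCoalgebra.IsCofree (C : UnitalCoalgebra.{w} K) : Prop :=
  ∃ (V : GradedSpace.{w} K) (e : C ≃ₗ[K] tensorCoalgebra V),
    IsUnitalCoalgebraMap C (tensorCoalgebra V) e.toLinearMap

/-- Concatenation of tensors. -/
def concat (V : GradedSpace.{w} K) :
    tensorCoalgebra V →ₗ[K] tensorCoalgebra V →ₗ[K] tensorCoalgebra V :=
  LinearMap.mul K (TensorAlgebra K V)

/-- The linear map `T(f) : T^c(V) → T^c(W)`, `v₁ ⋯ v_k ↦ f(v₁) ⋯ f(v_k)`. -/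
def tensorMap {V : GradedSpace.{w₁} K} {W : GradedSpace.{w₂} K} (f : V →ₗ[K] W) :
    tensorCoalgebra V →ₗ[K] tensorCoalgebra W :=
  (TensorAlgebra.lift K (TensorAlgebra.ι K ∘ₗ f)).toLinearMap

end TensorCoalgebra

/-! ### Bialgebra structures on a unital coalgebra -/

section Bialgebra

variable {K : Type u} [Field K]

/-- `mul` is an associative product of degree zero, with unit the unit of `C`. -/
structure IsAlgebra (C : UnitalCoalgebra.{w} K) (mul : C →ₗ[K] C →ₗ[K] C) : Prop where
  mul_mem : ∀ i j : ℤ, ∀ x ∈ C.deg i, ∀ y ∈ C.deg j, mul x y ∈ C.deg (i + j)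
  mul_assoc : ∀ x y z : C, mul (mul x y) z = mul x (mul y z)
  one_mul : ∀ x : C, mul C.one x = x
  mul_one : ∀ x : C, mul x C.one = x

/-- `(C, mul, Δ)` is a differential graded bialgebra with differential `d`. The multiplication is a
map of coalgebras `C ⊗ C → C`, where `C ⊗ C` has the comultiplication `(23) (Δ ⊗ Δ)` with Koszul
signs and the counit `ε ⊗ ε`. The differential has degree `-1` and square zero and it is both a
derivation and a coderivation; here `(id ⊗ d)(x ⊗ y) = (-1)^|x| x ⊗ d y`. -/
structure IsDGBialgebra (C : UnitalCoalgebra.{w} K) (mul : C →ₗ[K] C →ₗ[K] C) (d : C →ₗ[K] C) :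
    Prop extends IsAlgebra C mul where
  comul_mul : Coalgebra.comul ∘ₗ TensorProduct.lift mul =
    TensorProduct.map (TensorProduct.lift mul) (TensorProduct.lift mul) ∘ₗ
      middleSwap C.toGradedSpace C.toGradedSpace C.toGradedSpace C.toGradedSpace ∘ₗ
        TensorProduct.map Coalgebra.comul Coalgebra.comul
  counit_mul : ∀ x y : C, Coalgebra.counit (R := K) (mul x y) =
    Coalgebra.counit (R := K) x * Coalgebra.counit (R := K) y
  d_degree : HasDegree C.toGradedSpace C.toGradedSpace (-1) d
  d_one : d C.one = 0
  d_comp_d : d ∘ₗ d = 0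
  d_mul : d ∘ₗ TensorProduct.lift mul = TensorProduct.lift mul ∘ₗ
    (TensorProduct.map d LinearMap.id + TensorProduct.map (signMap C.toGradedSpace) d)
  comul_d : Coalgebra.comul ∘ₗ d =
    (TensorProduct.map d LinearMap.id + TensorProduct.map (signMap C.toGradedSpace) d) ∘ₗ
      Coalgebra.comul

/-- `(C, mul, Δ)` is a unital infinitesimal bialgebra:
`Δ(x y) = x₍₁₎ ⊗ x₍₂₎ y + x y₍₁₎ ⊗ y₍₂₎ - x ⊗ y`. -/
structure IsInfinitesimalBialgebra (C : UnitalCoalgebra.{w} K) (mul : C →ₗ[K] C →ₗ[K] C) :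
    Prop extends IsAlgebra C mul where
  comul_mul : ∀ x y : C, Coalgebra.comul (R := K) (mul x y) =
    TensorProduct.map LinearMap.id (mul.flip y) (Coalgebra.comul (R := K) x) +
      TensorProduct.map (mul x) LinearMap.id (Coalgebra.comul (R := K) y) - x ⊗ₜ[K] y

end Bialgebra

/-! ### `B_∞` algebras -/

/-- A `B_∞` algebra: a graded vector space `V` with a product `mul` and a differential `d` making the
tensor coalgebra `T^c(V)`, with its deconcatenation coproduct and its unit the empty word, a
differential graded bialgebra. -/
structure BInfAlgebra (K : Type u) [Field K] extends GradedSpace.{w} K where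
  mul : tensorCoalgebra toGradedSpace →ₗ[K]
    tensorCoalgebra toGradedSpace →ₗ[K] tensorCoalgebra toGradedSpace
  d : tensorCoalgebra toGradedSpace →ₗ[K] tensorCoalgebra toGradedSpace
  isDGBialgebra : IsDGBialgebra (tensorCoalgebra toGradedSpace) mul d

/-- A homomorphism of `B_∞` algebras: a linear map `f : A → B` of degree zero such that `T(f)`
commutes with the products and the differentials of `T^c(A)` and `T^c(B)`. -/
@[ext]
structure BInfAlgebra.Hom {K : Type u} [Field K] (A B : BInfAlgebra.{w} K) where
  toLinearMap : A.toGradedSpace →ₗ[K] B.toGradedSpace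
  degree : HasDegree A.toGradedSpace B.toGradedSpace 0 toLinearMap
  map_mul : ∀ x y, tensorMap toLinearMap (A.mul x y) =
    B.mul (tensorMap toLinearMap x) (tensorMap toLinearMap y)
  map_d : ∀ x, tensorMap toLinearMap (A.d x) = B.d (tensorMap toLinearMap x)

section Functoriality

variable {K : Type u} [Field K]

theorem tensorMap_id (V : GradedSpace.{w} K) :
    tensorMap (LinearMap.id : V →ₗ[K] V) = LinearMap.id := by
  have h : TensorAlgebra.lift K (TensorAlgebra.ι K ∘ₗ (LinearMap.id : V →ₗ[K] V)) =
      AlgHom.id K _ := by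
    apply TensorAlgebra.hom_ext; ext x; simp
  unfold tensorMap
  rw [h]
  rfl

theorem tensorMap_comp {V₁ V₂ V₃ : GradedSpace.{w} K} (g : V₂ →ₗ[K] V₃) (f : V₁ →ₗ[K] V₂) :
    tensorMap (g ∘ₗ f) = tensorMap g ∘ₗ tensorMap f := by
  have h : TensorAlgebra.lift K (TensorAlgebra.ι K ∘ₗ (g ∘ₗ f)) =
      (TensorAlgebra.lift K (TensorAlgebra.ι K ∘ₗ g)).comp
        (TensorAlgebra.lift K (TensorAlgebra.ι K ∘ₗ f)) := by
    apply TensorAlgebra.hom_ext; ext x; simp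
  unfold tensorMap
  rw [h]
  rfl

instance : Category (BInfAlgebra.{w} K) where
  Hom := BInfAlgebra.Hom
  id A :=
    { toLinearMap := LinearMap.id
      degree := fun n x hx => by simpa using hx
      map_mul := fun x y => by simp [tensorMap_id]
      map_d := fun x => by simp [tensorMap_id] }
  comp f g :=
    { toLinearMap := g.toLinearMap ∘ₗ f.toLinearMap
      degree := fun n x hx => by
        have := g.degree _ _ (f.degree n x hx)
        simpa using this
      map_mul := fun x y => by
        simp [tensorMap_comp, f.map_mul, g.map_mul]
      map_d := fun x => by simp [tensorMap_comp, f.map_d, g.map_d] }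

end Functoriality

/-! ### 2-associative differential bialgebras -/

/-- A 2-associative differential bialgebra: a unital coalgebra with a product `mul` (written `•`), a
differential `d` and a second product `circ` (written `∘`), all with the same unit, such that
`(•, d, Δ)` is a differential graded bialgebra and `(∘, Δ)` a unital infinitesimal bialgebra. -/
structure TwoAssBialgebra (K : Type u) [Field K] extends UnitalCoalgebra.{w} K where
  mul : toUnitalCoalgebra →ₗ[K] toUnitalCoalgebra →ₗ[K] toUnitalCoalgebra
  d : toUnitalCoalgebra →ₗ[K] toUnitalCoalgebra
  circ : toUnitalCoalgebra →ₗ[K] toUnitalCoalgebra →ₗ[K] toUnitalCoalgebra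
  isDGBialgebra : IsDGBialgebra toUnitalCoalgebra mul d
  isInfinitesimalBialgebra : IsInfinitesimalBialgebra toUnitalCoalgebra circ

/-- A homomorphism of 2-associative differential bialgebras: a linear map of degree zero that
preserves all the structure. -/
@[ext]
structure TwoAssBialgebra.Hom {K : Type u} [Field K] (V W : TwoAssBialgebra.{w} K) where
  toLinearMap : V.toUnitalCoalgebra →ₗ[K] W.toUnitalCoalgebra
  isUnitalCoalgebraMap :
    IsUnitalCoalgebraMap V.toUnitalCoalgebra W.toUnitalCoalgebra toLinearMap
  map_mul : ∀ x y, toLinearMap (V.mul x y) = W.mul (toLinearMap x) (toLinearMap y)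
  map_d : ∀ x, toLinearMap (V.d x) = W.d (toLinearMap x)
  map_circ : ∀ x y, toLinearMap (V.circ x y) = W.circ (toLinearMap x) (toLinearMap y)

section Categories

variable {K : Type u} [Field K]

theorem IsUnitalCoalgebraMap.id (C : UnitalCoalgebra.{w} K) :
    IsUnitalCoalgebraMap C C LinearMap.id where
  degree n x hx := by simpa using hx
  comul := by simp
  counit := by simp
  one := rfl

theorem IsUnitalCoalgebraMap.comp {C D E : UnitalCoalgebra.{w} K} {g : D →ₗ[K] E} {f : C →ₗ[K] D}
    (hg : IsUnitalCoalgebraMap D E g) (hf : IsUnitalCoalgebraMap C D f) :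
    IsUnitalCoalgebraMap C E (g ∘ₗ f) where
  degree n x hx := by
    have := hg.degree _ _ (hf.degree n x hx)
    simpa using this
  comul := by
    rw [← LinearMap.comp_assoc, hg.comul, LinearMap.comp_assoc, hf.comul, ← LinearMap.comp_assoc,
      TensorProduct.map_comp]
  counit := by rw [← LinearMap.comp_assoc, hg.counit, hf.counit]
  one := by rw [LinearMap.comp_apply, hf.one, hg.one]

instance : Category (TwoAssBialgebra.{w} K) where
  Hom := TwoAssBialgebra.Hom
  id V :=
    { toLinearMap := LinearMap.id
      isUnitalCoalgebraMap := IsUnitalCoalgebraMap.id _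
      map_mul := fun _ _ => rfl
      map_d := fun _ => rfl
      map_circ := fun _ _ => rfl }
  comp f g :=
    { toLinearMap := g.toLinearMap ∘ₗ f.toLinearMap
      isUnitalCoalgebraMap := g.isUnitalCoalgebraMap.comp f.isUnitalCoalgebraMap
      map_mul := fun x y => by simp [f.map_mul, g.map_mul]
      map_d := fun x => by simp [f.map_d, g.map_d]
      map_circ := fun x y => by simp [f.map_circ, g.map_circ] }

variable (K)

/-- The conilpotent 2-associative differential bialgebras. -/
def conilpotent : ObjectProperty (TwoAssBialgebra.{w} K) :=
  fun V => V.toUnitalCoalgebra.IsConilpotent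

/-- The cofree 2-associative differential bialgebras. -/
def cofree : ObjectProperty (TwoAssBialgebra.{w} K) :=
  fun V => V.toUnitalCoalgebra.IsCofree

variable {K}

/-! ### The universal enveloping functor -/

theorem concat_isInfinitesimalBialgebra (V : GradedSpace.{w} K) :
    IsInfinitesimalBialgebra (tensorCoalgebra V) (concat V) where
  mul_mem _ _ _ hx _ hy := wordDeg_mul V hx hy
  mul_assoc x y z := _root_.mul_assoc (G := TensorAlgebra K V) x y z
  one_mul x := _root_.one_mul (M := TensorAlgebra K V) x
  mul_one x := _root_.mul_one (M := TensorAlgebra K V) x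
  comul_mul x y := deconc_mul' (K := K) (V := V) x y

theorem tensorMap_isUnitalCoalgebraMap {V W : GradedSpace.{w} K} (f : V →ₗ[K] W)
    (hf : HasDegree V W 0 f) :
    IsUnitalCoalgebraMap (tensorCoalgebra V) (tensorCoalgebra W) (tensorMap f) where
  degree n x hx := by
    rw [add_zero]
    exact lift_mem_wordDeg f hf n x hx
  comul := LinearMap.ext (deconc_lift f)
  counit := LinearMap.ext (wordCounit_lift f)
  one := map_one (TensorAlgebra.lift K (TensorAlgebra.ι K ∘ₗ f))

variable (K)

/-- The universal enveloping functor `U`: it sends a `B_∞` algebra `A` to `T^c(A)` with the product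
and the differential of the `B_∞` structure, with concatenation as the second product and with
deconcatenation as the coproduct, and it sends `f` to `T(f)`. -/
def envelope : BInfAlgebra.{max u v} K ⥤ TwoAssBialgebra.{max u v} K where
  obj A :=
    { toUnitalCoalgebra := tensorCoalgebra A.toGradedSpace
      mul := A.mul
      d := A.d
      circ := concat A.toGradedSpace
      isDGBialgebra := A.isDGBialgebra
      isInfinitesimalBialgebra := concat_isInfinitesimalBialgebra A.toGradedSpace }
  map f :=
    { toLinearMap := tensorMap f.toLinearMap
      isUnitalCoalgebraMap := tensorMap_isUnitalCoalgebraMap f.toLinearMap f.degree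
      map_mul := f.map_mul
      map_d := f.map_d
      map_circ := map_mul (TensorAlgebra.lift K (TensorAlgebra.ι K ∘ₗ f.toLinearMap)) }
  map_id A := TwoAssBialgebra.Hom.ext (tensorMap_id A.toGradedSpace)
  map_comp f g := TwoAssBialgebra.Hom.ext (tensorMap_comp g.toLinearMap f.toLinearMap)

end Categories

end BInfinity

end

noncomputable section

namespace BInfinity

/-! ### Linear algebra over a field -/

section LinearAlgebra

variable {K : Type u} [Field K]

/-! Everything rests on a structure theorem for conilpotent unital infinitesimal bialgebras `(C, ∘,
Δ)`: such a `C` is the tensor coalgebra on its graded space `P` of primitive elements, and `∘`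
becomes concatenation. The comparison map `T^c(P) → C` multiplies the letters of a word with `∘`;
the infinitesimal compatibility of `∘` and `Δ` makes it a map of coalgebras
(`wordMap_isUnitalCoalgebraMap`).

Its bijectivity (`wordMap_primitiveIncl_bijective`) is an induction along the filtration by kernels
of the iterated reduced comultiplications, which exhausts the kernel of the counit by conilpotence.
A coalgebra map out of a conilpotent coalgebra is injective once it is so on primitives, and the
primitives of `T^c(P)` are the letters. For surjectivity, the reduced comultiplication of `x` lifts
by induction to some `t` in `T(P) ⊗ T(P)`, which inherits coassociativity by injectivity. In a
tensor coalgebra every reduced tensor with this cocycle property is the reduced comultiplication of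
an explicit element (`reducedComul_prependLetter_of_cocycle`). The image of that element differs
from `x` by a primitive, up to the unit, and primitives lie in the range.

Essential surjectivity of `U` follows by transporting `•` and `∂` to `T^c(P)`. `U` is full because a
coalgebra map preserves primitives, hence sends letters to letters, and compatibility with
concatenation then makes it `T(f)`; it is faithful because `T(f)` determines `f` on letters. Finally
`T^c(V)` is conilpotent, so the conilpotent and the cofree objects coincide.

Kernels and ranges in tensor products are handled throughout by linear splittings, which exist over
a field. -/

theorem exists_comp_eq_of_ker_le {V W₁ W₂ : Type*} [AddCommGroup V] [Module K V]
    [AddCommGroup W₁] [Module K W₁] [AddCommGroup W₂] [Module K W₂]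
    (f : V →ₗ[K] W₁) (g : V →ₗ[K] W₂) (h : LinearMap.ker f ≤ LinearMap.ker g) :
    ∃ z : W₁ →ₗ[K] W₂, g = z ∘ₗ f := by
  -- The map induced by `f` on `V / ker f` is injective, hence has a linear retraction `q`; then `g`
  -- is recovered by passing through this quotient.
  obtain ⟨q, hq⟩ := LinearMap.exists_leftInverse_of_injective
    ((LinearMap.ker f).liftQ f le_rfl) (Submodule.ker_liftQ_eq_bot' _ _ rfl)
  refine ⟨(LinearMap.ker f).liftQ g h ∘ₗ q, LinearMap.ext fun x => ?_⟩
  have := LinearMap.congr_fun hq ((LinearMap.ker f).mkQ x)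
  simp only [LinearMap.comp_apply, Submodule.mkQ_apply, Submodule.liftQ_apply,
    LinearMap.id_apply] at this ⊢
  rw [this, Submodule.liftQ_apply]

/-- Over a field, a linear map has a projection onto its kernel. -/
theorem exists_ker_projection {V W : Type*} [AddCommGroup V] [Module K V]
    [AddCommGroup W] [Module K W] (f : V →ₗ[K] W) :
    ∃ (p : V →ₗ[K] V) (q : W →ₗ[K] V), f ∘ₗ p = 0 ∧ LinearMap.id = p + q ∘ₗ f := by
  obtain ⟨P, hP⟩ := Submodule.exists_isCompl (LinearMap.ker f)
  obtain ⟨q, hq⟩ := exists_comp_eq_of_ker_le f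
    (LinearMap.id - (LinearMap.ker f).subtype ∘ₗ
      (LinearMap.ker f).projectionOnto P hP) (by
      intro x hx
      have := Submodule.projectionOnto_apply_left hP ⟨x, hx⟩
      simp [LinearMap.mem_ker, this])
  refine ⟨(LinearMap.ker f).subtype ∘ₗ (LinearMap.ker f).projectionOnto P hP, q, ?_, ?_⟩
  · exact LinearMap.ext fun x => ((LinearMap.ker f).projectionOnto P hP x).2
  · rw [← hq]; abel

end LinearAlgebra

/-! ### Words -/

section Words

variable {K : Type u} [Field K] {V : Type w} [AddCommGroup V] [Module K V]

theorem ιInv_ι (v : V) : TensorAlgebra.ιInv (TensorAlgebra.ι K v) = v :=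
  TensorAlgebra.ι_leftInverse v

theorem ιInv_one : TensorAlgebra.ιInv (1 : TensorAlgebra K V) = 0 := by
  -- `ιInv` is the `V`-component of the algebra map to the square-zero extension `K ⊕ V`; the
  -- opposite action is only there to give that extension its ring structure.
  let _ : Module Kᵐᵒᵖ V := Module.compHom _ ((RingHom.id K).fromOpposite mul_comm)
  have _ : IsCentralScalar K V := ⟨fun r m => rfl⟩
  change (TensorAlgebra.toTrivSqZeroExt 1 : TrivSqZeroExt K V).snd = 0
  rw [map_one, TrivSqZeroExt.snd_one]

theorem ιInv_ι_mul (v : V) (x : TensorAlgebra K V) :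
    TensorAlgebra.ιInv (TensorAlgebra.ι K v * x) = wordCounit V x • v := by
  let _ : Module Kᵐᵒᵖ V := Module.compHom _ ((RingHom.id K).fromOpposite mul_comm)
  have _ : IsCentralScalar K V := ⟨fun r m => rfl⟩
  have h : ∀ x : TensorAlgebra K V,
      (TensorAlgebra.toTrivSqZeroExt x : TrivSqZeroExt K V).fst = wordCounit V x := by
    intro x
    induction x using word_induction with
    | one => simp [wordCounit_one]
    | cons v x hx => simp [wordCounit_ι_mul]
    | add x y hx hy => simp [hx, hy]
    | smul a x hx => simp [hx]
  change (TensorAlgebra.toTrivSqZeroExt (TensorAlgebra.ι K v * x) : TrivSqZeroExt K V).snd = _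
  rw [map_mul, TrivSqZeroExt.snd_mul]
  simp [h]

theorem wordCounit_mul (x y : TensorAlgebra K V) :
    wordCounit V (x * y) = wordCounit V x * wordCounit V y :=
  map_mul (TensorAlgebra.algebraMapInv : TensorAlgebra K V →ₐ[K] K) x y

theorem wordCounit_ι (v : V) : wordCounit V (TensorAlgebra.ι K v) = 0 := by
  simpa using wordCounit_ι_mul v (1 : TensorAlgebra K V)

theorem ιInv_mul_ι (x : TensorAlgebra K V) (v : V) :
    TensorAlgebra.ιInv (x * TensorAlgebra.ι K v) = wordCounit V x • v := by
  induction x using word_induction with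
  | one => simp [wordCounit_one, ιInv_ι]
  | cons v x hx => rw [mul_assoc, ιInv_ι_mul, wordCounit_mul, wordCounit_ι, wordCounit_ι_mul]; simp
  | add x y hx hy => simp [hx, hy, add_mul, add_smul]
  | smul a x hx => simp [hx, mul_smul]

theorem tensor_mul_left (a : TensorAlgebra K V) (t : TensorAlgebra K V ⊗[K] TensorAlgebra K V) :
    (a ⊗ₜ[K] 1) * t = (LinearMap.mulLeft K a).rTensor _ t := by
  induction t with
  | zero => simp
  | add a b ha hb => simp only [mul_add, map_add, ha, hb]
  | tmul a b => simp [Algebra.TensorProduct.tmul_mul_tmul]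

theorem tensor_mul_right (a : TensorAlgebra K V) (t : TensorAlgebra K V ⊗[K] TensorAlgebra K V) :
    t * (1 ⊗ₜ[K] a) = (LinearMap.mulRight K a).lTensor _ t := by
  induction t with
  | zero => simp
  | add a b ha hb => simp only [add_mul, map_add, ha, hb]
  | tmul a b => simp [Algebra.TensorProduct.tmul_mul_tmul]

/-- Splitting off the first letter. -/
theorem rTensor_ιInv_deconc (v : V) (x : TensorAlgebra K V) :
    (TensorAlgebra.ιInv (R := K) (M := V)).rTensor _ (deconc V (TensorAlgebra.ι K v * x)) =
      v ⊗ₜ[K] x := by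
  -- On words beginning with `v`, the projection to letters is `v` times the counit, so the counit
  -- axiom collapses the sum over all splittings.
  have h' : TensorAlgebra.ιInv (R := K) (M := V) ∘ₗ LinearMap.mulLeft K (TensorAlgebra.ι K v) =
      LinearMap.toSpanSingleton K V v ∘ₗ wordCounit V := LinearMap.ext fun a => by
        simp [ιInv_ι_mul]
  rw [deconc_ι_mul, map_add, tensor_mul_left, ← LinearMap.comp_apply, ← LinearMap.rTensor_comp, h',
    LinearMap.rTensor_comp, LinearMap.comp_apply, rTensor_wordCounit_deconc]
  simp [ιInv_one]

/-- Splitting off the last letter. -/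
theorem lTensor_ιInv_deconc (x : TensorAlgebra K V) (v : V) :
    (TensorAlgebra.ιInv (R := K) (M := V)).lTensor _ (deconc V (x * TensorAlgebra.ι K v)) =
      x ⊗ₜ[K] v := by
  have h' : TensorAlgebra.ιInv (R := K) (M := V) ∘ₗ LinearMap.mulRight K (TensorAlgebra.ι K v) =
      LinearMap.toSpanSingleton K V v ∘ₗ wordCounit V := LinearMap.ext fun a => by
        simp [ιInv_mul_ι]
  have h1 : deconc V (TensorAlgebra.ι K v) =
      TensorAlgebra.ι K v ⊗ₜ[K] 1 + 1 ⊗ₜ[K] TensorAlgebra.ι K v := by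
    simpa [deconc_one, Algebra.TensorProduct.tmul_mul_tmul] using
      deconc_ι_mul v (1 : TensorAlgebra K V)
  rw [deconc_mul, map_sub, map_add, tensor_mul_right, ← LinearMap.comp_apply,
    ← LinearMap.lTensor_comp, h', LinearMap.lTensor_comp, LinearMap.comp_apply,
    lTensor_wordCounit_deconc, h1]
  simp [ιInv_one, ιInv_ι, mul_add, Algebra.TensorProduct.tmul_mul_tmul]

/-- Deconcatenating and projecting the first factor to letters undoes the multiplication. This
allows iterated comultiplications, which take values in a tensor algebra, to be tested for zero in
an ordinary tensor product. -/
theorem prepend_injective :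
    Function.Injective (LinearMap.mul' K (TensorAlgebra K V) ∘ₗ
      (TensorAlgebra.ι K (M := V)).rTensor (TensorAlgebra K V)) := by
  refine Function.LeftInverse.injective
    (g := (TensorAlgebra.ιInv (R := K) (M := V)).rTensor _ ∘ₗ deconc V) fun t => ?_
  induction t with
  | zero => simp
  | add a b ha hb => simp only [map_add, ha, hb]
  | tmul a b => simpa using rTensor_ιInv_deconc a b

theorem append_injective :
    Function.Injective (LinearMap.mul' K (TensorAlgebra K V) ∘ₗ
      (TensorAlgebra.ι K (M := V)).lTensor (TensorAlgebra K V)) := by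
  refine Function.LeftInverse.injective
    (g := (TensorAlgebra.ιInv (R := K) (M := V)).lTensor _ ∘ₗ deconc V) fun t => ?_
  induction t with
  | zero => simp
  | add a b ha hb => simp only [map_add, ha, hb]
  | tmul a b => simpa using lTensor_ιInv_deconc a b

/-- The map `a ⊗ b ↦ a b` if `a` is a letter, `0` if `a` is a word of another length. -/
def prependLetter (V : Type w) [AddCommGroup V] [Module K V] :
    TensorAlgebra K V ⊗[K] TensorAlgebra K V →ₗ[K] TensorAlgebra K V :=
  LinearMap.mul' K (TensorAlgebra K V) ∘ₗ (TensorAlgebra.ι K ∘ₗ TensorAlgebra.ιInv).rTensor _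

theorem prependLetter_tmul (a b : TensorAlgebra K V) :
    prependLetter V (a ⊗ₜ[K] b) = TensorAlgebra.ι K (TensorAlgebra.ιInv a) * b := by
  simp [prependLetter]

/-- Of all the splittings of a word only the one after its first letter survives, and it gives the
word back; the empty word has no such splitting. -/
theorem prependLetter_deconc (x : TensorAlgebra K V) :
    prependLetter V (deconc V x) = x - wordCounit V x • 1 := by
  induction x using word_induction with
  | one => simp [deconc_one, prependLetter_tmul, ιInv_one, wordCounit_one]
  | cons v x hx =>
    rw [prependLetter, LinearMap.rTensor_comp, LinearMap.comp_apply, LinearMap.comp_apply,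
      rTensor_ιInv_deconc, wordCounit_ι_mul]
    simp
  | add a b ha hb => simp only [map_add, ha, hb, add_smul]; abel
  | smul c a ha => simp only [map_smul, ha, smul_sub, smul_assoc]

end Words

/-! ### The reduced comultiplication -/

section Reduced

variable {K : Type u} [Field K]

theorem reducedProj_apply (C : UnitalCoalgebra.{w} K) (x : C) :
    reducedProj C x = x - Coalgebra.counit (R := K) x • C.one := rfl

theorem reducedProj_one (C : UnitalCoalgebra.{w} K) : reducedProj C C.one = 0 := by
  simp [reducedProj_apply, C.counit_one]

theorem reducedProj_of_counit (C : UnitalCoalgebra.{w} K) {x : C}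
    (hx : Coalgebra.counit (R := K) x = 0) : reducedProj C x = x := by
  simp [reducedProj_apply, hx]

theorem counit_comp_reducedProj (C : UnitalCoalgebra.{w} K) :
    Coalgebra.counit (R := K) ∘ₗ reducedProj C = 0 := by
  ext x
  simp [reducedProj_apply, C.counit_one]

theorem reducedProj_comp_reducedProj (C : UnitalCoalgebra.{w} K) :
    reducedProj C ∘ₗ reducedProj C = reducedProj C :=
  LinearMap.ext fun x =>
    reducedProj_of_counit C (LinearMap.congr_fun (counit_comp_reducedProj C) x)

theorem reducedComul_one (C : UnitalCoalgebra.{w} K) : reducedComul C C.one = 0 := by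
  simp [reducedComul, C.comul_one, reducedProj_one]

theorem reducedComul_comp_reducedProj (C : UnitalCoalgebra.{w} K) :
    reducedComul C ∘ₗ reducedProj C = reducedComul C := by
  ext x
  simp [reducedProj_apply, reducedComul_one]

theorem map_reducedProj_comp_reducedComul (C : UnitalCoalgebra.{w} K) :
    TensorProduct.map (reducedProj C) (reducedProj C) ∘ₗ reducedComul C = reducedComul C := by
  rw [reducedComul, ← LinearMap.comp_assoc, ← TensorProduct.map_comp,
    reducedProj_comp_reducedProj]

theorem lTensor_counit_reducedComul (C : UnitalCoalgebra.{w} K) (x : C) :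
    (Coalgebra.counit (R := K) (A := C)).lTensor C (reducedComul C x) = 0 := by
  rw [reducedComul, ← LinearMap.comp_apply, ← LinearMap.comp_assoc, LinearMap.lTensor_comp_map,
    counit_comp_reducedProj, TensorProduct.map_zero_right, LinearMap.zero_comp,
    LinearMap.zero_apply]

theorem rTensor_counit_reducedComul (C : UnitalCoalgebra.{w} K) (x : C) :
    (Coalgebra.counit (R := K) (A := C)).rTensor C (reducedComul C x) = 0 := by
  rw [reducedComul, ← LinearMap.comp_apply, ← LinearMap.comp_assoc, LinearMap.rTensor_comp_map,
    counit_comp_reducedProj, TensorProduct.map_zero_left, LinearMap.zero_comp,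
    LinearMap.zero_apply]

/-- The reduced comultiplication is coassociative. -/
theorem reducedComul_coassoc (C : UnitalCoalgebra.{w} K) :
    (TensorProduct.assoc K C C C).toLinearMap ∘ₗ (reducedComul C).rTensor C ∘ₗ reducedComul C =
      (reducedComul C).lTensor C ∘ₗ reducedComul C := by
  -- Both iterates are `J ⊗ J ⊗ J` applied to an iterate of the full comultiplication: the inner `J`
  -- is absorbed, since the reduced comultiplication kills the unit. Coassociativity of `Δ` then
  -- suffices.
  have h1 : (reducedComul C).rTensor C ∘ₗ reducedComul C =
      TensorProduct.map (TensorProduct.map (reducedProj C) (reducedProj C)) (reducedProj C) ∘ₗ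
        (Coalgebra.comul (R := K) (A := C)).rTensor C ∘ₗ Coalgebra.comul := by
    conv_lhs => enter [2]; rw [reducedComul]
    rw [← LinearMap.comp_assoc, LinearMap.rTensor_comp_map, reducedComul_comp_reducedProj,
      reducedComul, ← LinearMap.comp_assoc, LinearMap.map_comp_rTensor]
  have h2 : (reducedComul C).lTensor C ∘ₗ reducedComul C =
      TensorProduct.map (reducedProj C) (TensorProduct.map (reducedProj C) (reducedProj C)) ∘ₗ
        (Coalgebra.comul (R := K) (A := C)).lTensor C ∘ₗ Coalgebra.comul := by
    conv_lhs => enter [2]; rw [reducedComul]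
    rw [← LinearMap.comp_assoc, LinearMap.lTensor_comp_map, reducedComul_comp_reducedProj,
      reducedComul, ← LinearMap.comp_assoc, LinearMap.map_comp_lTensor]
  rw [h1, h2, ← Coalgebra.coassoc]
  simp only [← LinearMap.comp_assoc]
  congr 2
  rw [TensorProduct.map_map_comp_assoc_eq]

theorem IsUnitalCoalgebraMap.comp_reducedProj {C : UnitalCoalgebra.{w₁} K}
    {D : UnitalCoalgebra.{w₂} K} {f : C →ₗ[K] D} (hf : IsUnitalCoalgebraMap C D f) :
    f ∘ₗ reducedProj C = reducedProj D ∘ₗ f := by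
  ext x
  have := LinearMap.congr_fun hf.counit x
  rw [LinearMap.comp_apply] at this
  simp [reducedProj_apply, hf.one, this]

theorem IsUnitalCoalgebraMap.reducedComul_comp {C : UnitalCoalgebra.{w₁} K}
    {D : UnitalCoalgebra.{w₂} K} {f : C →ₗ[K] D} (hf : IsUnitalCoalgebraMap C D f) :
    reducedComul D ∘ₗ f = TensorProduct.map f f ∘ₗ reducedComul C := by
  rw [reducedComul, LinearMap.comp_assoc, hf.comul, ← LinearMap.comp_assoc,
    ← TensorProduct.map_comp, ← hf.comp_reducedProj, TensorProduct.map_comp, LinearMap.comp_assoc,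
    reducedComul]

theorem iteratedReducedComul_succ (C : UnitalCoalgebra.{w} K) (r : ℕ) :
    iteratedReducedComul C (r + 1) = (LinearMap.mul' K (TensorAlgebra K C) ∘ₗ
      (TensorAlgebra.ι K).rTensor _) ∘ₗ (iteratedReducedComul C r).lTensor C ∘ₗ
        reducedComul C := by
  rw [iteratedReducedComul, LinearMap.comp_assoc,
    ← LinearMap.comp_assoc _ _ (LinearMap.rTensor _ _), LinearMap.rTensor_comp_lTensor]

/-- The iterated reduced comultiplication can also be expanded in its first factor. -/
theorem iteratedReducedComul_succ' (C : UnitalCoalgebra.{w} K) (r : ℕ) :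
    iteratedReducedComul C (r + 1) = (LinearMap.mul' K (TensorAlgebra K C) ∘ₗ
      (TensorAlgebra.ι K).lTensor _) ∘ₗ (iteratedReducedComul C r).rTensor C ∘ₗ
        reducedComul C := by
  have aux : ∀ s : ℕ, (LinearMap.mul' K (TensorAlgebra K C) ∘ₗ
      (TensorAlgebra.ι K).lTensor _) ∘ₗ (iteratedReducedComul C s).rTensor C =
      LinearMap.mul' K (TensorAlgebra K C) ∘ₗ
        TensorProduct.map (iteratedReducedComul C s) (TensorAlgebra.ι K) := fun s => by
    rw [LinearMap.comp_assoc, LinearMap.lTensor_comp_rTensor]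
  rw [← LinearMap.comp_assoc, aux]
  induction r with
  | zero => rfl
  | succ r ih =>
    -- Associativity of the tensor algebra, to be matched with coassociativity: both expansions of
    -- the iterate split off one first and one last factor around the previous iterate.
    have key : (LinearMap.mul' K (TensorAlgebra K C) ∘ₗ
        TensorProduct.map (TensorAlgebra.ι K) (LinearMap.mul' K (TensorAlgebra K C) ∘ₗ
          TensorProduct.map (iteratedReducedComul C r) (TensorAlgebra.ι K))) ∘ₗ
        (TensorProduct.assoc K C C C).toLinearMap =
        LinearMap.mul' K (TensorAlgebra K C) ∘ₗ
        TensorProduct.map (LinearMap.mul' K (TensorAlgebra K C) ∘ₗ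
          TensorProduct.map (TensorAlgebra.ι K) (iteratedReducedComul C r)) (TensorAlgebra.ι K) := by
      ext a b c
      simp [mul_assoc]
    rw [iteratedReducedComul]
    conv_lhs => rw [ih]
    conv_rhs => rw [iteratedReducedComul]
    have e1 : TensorProduct.map (TensorAlgebra.ι K) ((LinearMap.mul' K (TensorAlgebra K C) ∘ₗ
          TensorProduct.map (iteratedReducedComul C r) (TensorAlgebra.ι K)) ∘ₗ reducedComul C) =
        TensorProduct.map (TensorAlgebra.ι K) (LinearMap.mul' K (TensorAlgebra K C) ∘ₗ
          TensorProduct.map (iteratedReducedComul C r) (TensorAlgebra.ι K)) ∘ₗ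
          (reducedComul C).lTensor C := by rw [LinearMap.map_comp_lTensor]
    have e2 : TensorProduct.map (LinearMap.mul' K (TensorAlgebra K C) ∘ₗ
          TensorProduct.map (TensorAlgebra.ι K) (iteratedReducedComul C r) ∘ₗ reducedComul C)
          (TensorAlgebra.ι K) =
        TensorProduct.map (LinearMap.mul' K (TensorAlgebra K C) ∘ₗ
          TensorProduct.map (TensorAlgebra.ι K) (iteratedReducedComul C r)) (TensorAlgebra.ι K) ∘ₗ
          (reducedComul C).rTensor C := by
      rw [LinearMap.map_comp_rTensor, LinearMap.comp_assoc]
    rw [e1, e2, LinearMap.comp_assoc, ← reducedComul_coassoc,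
      ← LinearMap.comp_assoc _ _ (LinearMap.mul' K _),
      ← LinearMap.comp_assoc _ (TensorProduct.assoc K C C C).toLinearMap, key]
    rfl

theorem iteratedReducedComul_succ_eq_zero_iff (C : UnitalCoalgebra.{w} K) (r : ℕ) (x : C) :
    iteratedReducedComul C (r + 1) x = 0 ↔
      (iteratedReducedComul C r).lTensor C (reducedComul C x) = 0 := by
  rw [iteratedReducedComul_succ]
  exact map_eq_zero_iff _ prepend_injective

theorem iteratedReducedComul_succ_eq_zero_iff' (C : UnitalCoalgebra.{w} K) (r : ℕ) (x : C) :
    iteratedReducedComul C (r + 1) x = 0 ↔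
      (iteratedReducedComul C r).rTensor C (reducedComul C x) = 0 := by
  rw [iteratedReducedComul_succ']
  exact map_eq_zero_iff _ append_injective

/-- The kernels form an increasing filtration: it starts at zero, and if one iterate factors
linearly through the previous one, so does its tensor product with the identity. -/
theorem ker_iteratedReducedComul_le_succ (C : UnitalCoalgebra.{w} K) (r : ℕ) :
    LinearMap.ker (iteratedReducedComul C r) ≤ LinearMap.ker (iteratedReducedComul C (r + 1)) := by
  induction r with
  | zero =>
    intro x hx
    have : x = 0 := (TensorAlgebra.ι_leftInverse (R := K) (M := C)).injective
      (by simpa [iteratedReducedComul] using hx)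
    simp [this]
  | succ r ih =>
    intro x hx
    rw [LinearMap.mem_ker, iteratedReducedComul_succ_eq_zero_iff] at hx ⊢
    obtain ⟨z, hz⟩ := exists_comp_eq_of_ker_le _ _ ih
    rw [hz, LinearMap.lTensor_comp, LinearMap.comp_apply, hx, map_zero]

theorem ker_iteratedReducedComul_mono (C : UnitalCoalgebra.{w} K) :
    Monotone fun r => LinearMap.ker (iteratedReducedComul C r) :=
  monotone_nat_of_le_succ (ker_iteratedReducedComul_le_succ C)

theorem iteratedReducedComul_one (C : UnitalCoalgebra.{w} K) :
    iteratedReducedComul C 1 C.one = 0 := by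
  rw [iteratedReducedComul_succ_eq_zero_iff, reducedComul_one, map_zero]

theorem IsUnitalCoalgebraMap.iteratedReducedComul_comp {C : UnitalCoalgebra.{w₁} K}
    {D : UnitalCoalgebra.{w₂} K} {f : C →ₗ[K] D} (hf : IsUnitalCoalgebraMap C D f) (r : ℕ) :
    iteratedReducedComul D r ∘ₗ f =
      (TensorAlgebra.lift K (TensorAlgebra.ι K ∘ₗ f)).toLinearMap ∘ₗ
        iteratedReducedComul C r := by
  induction r with
  | zero => ext x; simp [iteratedReducedComul]
  | succ r ih =>
    have key : (TensorAlgebra.lift K (TensorAlgebra.ι K ∘ₗ f)).toLinearMap ∘ₗ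
        LinearMap.mul' K (TensorAlgebra K C) ∘ₗ
          TensorProduct.map (TensorAlgebra.ι K) (iteratedReducedComul C r) =
        LinearMap.mul' K (TensorAlgebra K D) ∘ₗ
          TensorProduct.map (TensorAlgebra.ι K ∘ₗ f)
            ((TensorAlgebra.lift K (TensorAlgebra.ι K ∘ₗ f)).toLinearMap ∘ₗ
              iteratedReducedComul C r) := by
      ext a b
      simp
    rw [iteratedReducedComul, LinearMap.comp_assoc, LinearMap.comp_assoc, hf.reducedComul_comp,
      ← LinearMap.comp_assoc (reducedComul C) (TensorProduct.map f f), ← TensorProduct.map_comp, ih]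
    exact congrArg (· ∘ₗ reducedComul C) key.symm

/-- Iterates are natural in coalgebra maps, and `T(f)` is injective for injective `f`. -/
theorem UnitalCoalgebra.IsConilpotent.of_injective {C : UnitalCoalgebra.{w₁} K}
    {D : UnitalCoalgebra.{w₂} K} {f : C →ₗ[K] D} (hf : IsUnitalCoalgebraMap C D f)
    (hinj : Function.Injective f) (hD : D.IsConilpotent) : C.IsConilpotent := by
  intro x hx
  obtain ⟨r, hr⟩ := hD (f x) (by
    have := LinearMap.congr_fun hf.counit x
    rw [← hx, ← this]; rfl)
  refine ⟨r, ?_⟩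
  have h := LinearMap.congr_fun (hf.iteratedReducedComul_comp r) x
  rw [LinearMap.comp_apply, hr] at h
  -- `g` is only a linear retraction, not a map of coalgebras; this is enough for `T(g)` to be a
  -- left inverse of `T(f)`.
  obtain ⟨g, hg⟩ := LinearMap.exists_leftInverse_of_injective f (LinearMap.ker_eq_bot.2 hinj)
  have hl : (TensorAlgebra.lift K (TensorAlgebra.ι K ∘ₗ g)).comp
      (TensorAlgebra.lift K (TensorAlgebra.ι K ∘ₗ f)) = AlgHom.id K _ := by
    refine TensorAlgebra.hom_ext (LinearMap.ext fun y => ?_)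
    have := LinearMap.congr_fun hg y
    simp only [LinearMap.comp_apply, LinearMap.id_apply] at this
    simp [this]
  have := congrArg (TensorAlgebra.lift K (TensorAlgebra.ι K ∘ₗ g)) h
  rw [map_zero] at this
  exact ((AlgHom.congr_fun hl _).symm.trans this.symm)

end Reduced

/-! ### The reduced comultiplication of the tensor coalgebra -/

section TensorReduced

variable {K : Type u} [Field K] (V : GradedSpace.{w} K)

/-- The recursion for deconcatenation, reduced. The term with left factor `1` dies, and words
beginning with `v` are already reduced. Splitting what follows `v` in the left factor into its
reduced and constant parts gives the two summands; the constant part is evaluated by the counit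
axiom. -/
theorem reducedComul_ι_mul (v : V) (x : TensorAlgebra K V) :
    reducedComul (tensorCoalgebra V) (TensorAlgebra.ι K v * x) =
      TensorAlgebra.ι K v ⊗ₜ[K] reducedProj (tensorCoalgebra V) x +
        (LinearMap.mulLeft K (TensorAlgebra.ι K v)).rTensor _
          (reducedComul (tensorCoalgebra V) x) := by
  have h1 : reducedProj (tensorCoalgebra V) ∘ₗ LinearMap.mulLeft K (TensorAlgebra.ι K v) =
      LinearMap.mulLeft K (TensorAlgebra.ι K v) :=
    LinearMap.ext fun y => reducedProj_of_counit (tensorCoalgebra V) (wordCounit_ι_mul v y)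
  have h2 : LinearMap.mulLeft K (TensorAlgebra.ι K v) =
      LinearMap.mulLeft K (TensorAlgebra.ι K v) ∘ₗ reducedProj (tensorCoalgebra V) +
        LinearMap.toSpanSingleton K _ (TensorAlgebra.ι K v) ∘ₗ wordCounit V := by
    refine LinearMap.ext fun y => ?_
    change _ = TensorAlgebra.ι K v * (y - wordCounit V y • 1) +
      wordCounit V y • TensorAlgebra.ι K v
    rw [mul_sub, mul_smul_comm, mul_one]
    simp
  have h3 := rTensor_wordCounit_deconc (K := K) x
  change TensorProduct.map _ _ (deconc V _) = _ + _
  rw [deconc_ι_mul, map_add, tensor_mul_left, TensorProduct.map_tmul,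
    show reducedProj (tensorCoalgebra V) (1 : TensorAlgebra K V) = 0 from
      reducedProj_one (tensorCoalgebra V),
    TensorProduct.zero_tmul, add_zero, ← LinearMap.comp_apply, LinearMap.map_comp_rTensor, h1]
  conv_lhs => rw [h2]
  rw [TensorProduct.map_add_left, LinearMap.add_apply, add_comm]
  congr 1
  · rw [← LinearMap.map_comp_rTensor, LinearMap.comp_apply, h3]
    simp
  · rw [← LinearMap.rTensor_comp_map]
    rfl

theorem tensorCoalgebra_isConilpotent : (tensorCoalgebra V).IsConilpotent := by
  -- The counit condition is dropped because it is not inherited by the tail of a word; this is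
  -- harmless, as the unit is killed by the first iteration.
  suffices h : ∀ x : TensorAlgebra K V, ∃ r, iteratedReducedComul (tensorCoalgebra V) r x = 0 from
    fun x _ => h x
  intro x
  induction x using word_induction with
  | one => exact ⟨1, iteratedReducedComul_one (tensorCoalgebra V)⟩
  | cons v x hx =>
    obtain ⟨r, hr⟩ := hx
    have h1 := ker_iteratedReducedComul_le_succ (tensorCoalgebra V) r hr
    have h2 := ker_iteratedReducedComul_le_succ (tensorCoalgebra V) _ h1
    have h3 : iteratedReducedComul (tensorCoalgebra V) (r + 1) (tensorCoalgebra V).one = 0 :=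
      ker_iteratedReducedComul_mono (tensorCoalgebra V) (Nat.le_add_left 1 r)
        (iteratedReducedComul_one (tensorCoalgebra V))
    -- `r + 1` further steps must kill the tail reduced by a multiple of the unit. Since `r` may be
    -- `0` and the unit survives the zeroth iterate, `r` would not do.
    refine ⟨r + 2, ?_⟩
    rw [LinearMap.mem_ker] at h1 h2
    rw [iteratedReducedComul_succ_eq_zero_iff] at h2 ⊢
    rw [reducedComul_ι_mul, map_add, LinearMap.lTensor_tmul, reducedProj_apply, map_sub, map_smul,
      h1, h3, smul_zero, sub_zero, TensorProduct.tmul_zero, zero_add, ← LinearMap.comp_apply,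
      LinearMap.lTensor_comp_rTensor, ← LinearMap.rTensor_comp_lTensor, LinearMap.comp_apply, h2,
      map_zero]
  | add x y hx hy =>
    obtain ⟨r, hr⟩ := hx
    obtain ⟨s, hs⟩ := hy
    refine ⟨max r s, ?_⟩
    have h1 := ker_iteratedReducedComul_mono (tensorCoalgebra V) (le_max_left r s) hr
    have h2 := ker_iteratedReducedComul_mono (tensorCoalgebra V) (le_max_right r s) hs
    exact (LinearMap.ker (iteratedReducedComul (tensorCoalgebra V) (max r s))).add_mem h1 h2
  | smul a x hx =>
    obtain ⟨r, hr⟩ := hx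
    exact ⟨r, (LinearMap.ker (iteratedReducedComul (tensorCoalgebra V) r)).smul_mem a hr⟩

theorem ιInv_reducedProj (x : TensorAlgebra K V) :
    TensorAlgebra.ιInv (R := K) (M := V) (reducedProj (tensorCoalgebra V) x) =
      TensorAlgebra.ιInv x := by
  change TensorAlgebra.ιInv (x - wordCounit V x • 1) = _
  rw [map_sub, map_smul, ιInv_one, smul_zero, sub_zero]

/-- Shows that an element is recovered from its reduced comultiplication up to its components of
word length zero and one. In particular primitives are letters. -/
theorem prependLetter_reducedComul (x : TensorAlgebra K V) :
    prependLetter V (reducedComul (tensorCoalgebra V) x) =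
      reducedProj (tensorCoalgebra V) x - TensorAlgebra.ι K (TensorAlgebra.ιInv x) := by
  have h0 : wordCounit V (reducedProj (tensorCoalgebra V) x) = 0 :=
    LinearMap.congr_fun (counit_comp_reducedProj (tensorCoalgebra V)) x
  have h1 := reducedComul_apply (tensorCoalgebra V) _ h0
  rw [← LinearMap.comp_apply, reducedComul_comp_reducedProj] at h1
  rw [h1]
  change prependLetter V (deconc V _ - _ ⊗ₜ[K] (1 : TensorAlgebra K V) -
    (1 : TensorAlgebra K V) ⊗ₜ[K] _) = _
  rw [map_sub, map_sub, prependLetter_deconc, prependLetter_tmul, prependLetter_tmul, h0,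
    ιInv_reducedProj, ιInv_one]
  simp

/-- The primitive elements of the tensor coalgebra are the words of length one. -/
theorem eq_ι_ιInv_of_reducedComul_eq_zero {x : TensorAlgebra K V} (h0 : wordCounit V x = 0)
    (hx : reducedComul (tensorCoalgebra V) x = 0) :
    x = TensorAlgebra.ι K (TensorAlgebra.ιInv x) := by
  have h := prependLetter_reducedComul V x
  rw [hx, map_zero, reducedProj_of_counit (tensorCoalgebra V) h0] at h
  exact sub_eq_zero.1 h.symm

theorem reducedComul_ι (v : V) :
    reducedComul (tensorCoalgebra V) (TensorAlgebra.ι K v) = 0 := by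
  have h := reducedComul_ι_mul V v 1
  rw [show reducedProj (tensorCoalgebra V) (1 : TensorAlgebra K V) = 0 from
      reducedProj_one (tensorCoalgebra V),
    show reducedComul (tensorCoalgebra V) (1 : TensorAlgebra K V) = 0 from
      reducedComul_one (tensorCoalgebra V)] at h
  simpa using h

/-- The recursion `reducedComul_ι_mul`, extended from `v ⊗ x` to arbitrary tensors. Its last term
involves `id ⊗ Δ`, which is where a cocycle condition can be inserted. -/
theorem reducedComul_prependLetter (t : TensorAlgebra K V ⊗[K] TensorAlgebra K V) :
    reducedComul (tensorCoalgebra V) (prependLetter V t) =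
      TensorProduct.map (TensorAlgebra.ι K ∘ₗ TensorAlgebra.ιInv)
        (reducedProj (tensorCoalgebra V)) t +
      (prependLetter V).rTensor _ ((TensorProduct.assoc K _ _ _).symm
        ((reducedComul (tensorCoalgebra V)).lTensor (TensorAlgebra K V) t)) := by
  induction t with
  | zero => simp
  | add a b ha hb => simp only [map_add, ha, hb]; abel
  | tmul a b =>
    rw [prependLetter_tmul, reducedComul_ι_mul, TensorProduct.map_tmul, LinearMap.lTensor_tmul]
    congr 1
    generalize reducedComul (tensorCoalgebra V) b = s
    change TensorAlgebra K V ⊗[K] TensorAlgebra K V at s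
    induction s with
    | zero => simp
    | add a b ha hb => simp only [map_add, TensorProduct.tmul_add, ha, hb]
    | tmul c d => simp [prependLetter_tmul]

/-- A reduced element `t` of `T(V) ⊗ T(V)` with `(Δ ⊗ id) t = (id ⊗ Δ) t` is a reduced
comultiplication. -/
theorem reducedComul_prependLetter_of_cocycle (t : TensorAlgebra K V ⊗[K] TensorAlgebra K V)
    (h1 : TensorProduct.map (reducedProj (tensorCoalgebra V)) (reducedProj (tensorCoalgebra V)) t =
      t)
    (h2 : TensorProduct.assoc K _ _ _
        ((reducedComul (tensorCoalgebra V)).rTensor (TensorAlgebra K V) t) =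
      (reducedComul (tensorCoalgebra V)).lTensor (TensorAlgebra K V) t) :
    reducedComul (tensorCoalgebra V) (prependLetter V t) = t := by
  have e1 : prependLetter V ∘ₗ reducedComul (tensorCoalgebra V) =
      reducedProj (tensorCoalgebra V) - TensorAlgebra.ι K ∘ₗ TensorAlgebra.ιInv :=
    LinearMap.ext fun x => prependLetter_reducedComul V x
  have e2 : TensorAlgebra.ι K ∘ₗ TensorAlgebra.ιInv (R := K) (M := V) ∘ₗ
      reducedProj (tensorCoalgebra V) = TensorAlgebra.ι K ∘ₗ TensorAlgebra.ιInv :=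
    LinearMap.ext fun x => congrArg _ (ιInv_reducedProj V x)
  -- With the cocycle condition the last term becomes `((J - ι ιInv) ⊗ id) t` by `e1`. As `t` is
  -- reduced, this cancels the first term `(ι ιInv ⊗ J) t` and leaves `t`.
  rw [reducedComul_prependLetter, ← h2, LinearEquiv.symm_apply_apply, ← LinearMap.comp_apply,
    ← LinearMap.rTensor_comp, e1]
  conv_lhs => rw [← h1]
  rw [← LinearMap.comp_apply, ← LinearMap.comp_apply, ← TensorProduct.map_comp,
    LinearMap.rTensor_comp_map, reducedProj_comp_reducedProj, LinearMap.sub_comp,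
    reducedProj_comp_reducedProj, LinearMap.comp_assoc, e2, ← LinearMap.add_apply,
    ← TensorProduct.map_add_left, add_sub_cancel, h1]

end TensorReduced

/-! ### Injectivity and surjectivity on conilpotent coalgebras -/

section Conilpotent

variable {K : Type u} [Field K]

/-- Let `F r` be the common kernel of the `r`-th iterate and the counit. The reduced
comultiplication sends `F (r + 1)` into `F r ⊗ F r`, because the iterate and the counit each kill it
in either factor. A projection `p` onto `F r` expresses this without intersecting subspaces of a
tensor product. -/
theorem exists_projection_reducedComul (C : UnitalCoalgebra.{w} K) (r : ℕ) :
    ∃ p : C →ₗ[K] C,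
      (∀ y, iteratedReducedComul C r (p y) = 0 ∧ Coalgebra.counit (R := K) (p y) = 0) ∧
      ∀ x, iteratedReducedComul C (r + 1) x = 0 →
        TensorProduct.map p p (reducedComul C x) = reducedComul C x := by
  obtain ⟨p, q, hp, hq⟩ := exists_ker_projection
    ((iteratedReducedComul C r).prod (Coalgebra.counit (R := K) (A := C)))
  refine ⟨p, fun y => ?_, fun x hx => ?_⟩
  · have := LinearMap.congr_fun hp y
    simpa [LinearMap.prod_apply] using this
  · have hB : (iteratedReducedComul C r).prod (Coalgebra.counit (R := K) (A := C)) =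
        LinearMap.inl K _ _ ∘ₗ iteratedReducedComul C r +
          LinearMap.inr K _ _ ∘ₗ Coalgebra.counit := by
      ext x <;> simp
    have hl : p.lTensor C (reducedComul C x) = reducedComul C x := by
      have := congrArg (fun f => f.lTensor C (reducedComul C x)) hq
      simp only [LinearMap.lTensor_add, LinearMap.lTensor_id, LinearMap.id_apply,
        LinearMap.add_apply, hB, LinearMap.comp_add, LinearMap.lTensor_comp, LinearMap.comp_apply,
        (iteratedReducedComul_succ_eq_zero_iff C r x).1 hx, lTensor_counit_reducedComul,
        map_zero, add_zero] at this
      exact this.symm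
    have hr : p.rTensor C (reducedComul C x) = reducedComul C x := by
      have := congrArg (fun f => f.rTensor C (reducedComul C x)) hq
      simp only [LinearMap.rTensor_add, LinearMap.rTensor_id, LinearMap.id_apply,
        LinearMap.add_apply, hB, LinearMap.comp_add, LinearMap.rTensor_comp, LinearMap.comp_apply,
        (iteratedReducedComul_succ_eq_zero_iff' C r x).1 hx, rTensor_counit_reducedComul,
        map_zero, add_zero] at this
      exact this.symm
    rw [← LinearMap.lTensor_comp_rTensor, LinearMap.comp_apply, hr, hl]

/-- A map from a conilpotent coalgebra that is injective on primitive elements is injective. -/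
theorem IsUnitalCoalgebraMap.injective {C : UnitalCoalgebra.{w₁} K} {D : UnitalCoalgebra.{w₂} K}
    {f : C →ₗ[K] D} (hf : IsUnitalCoalgebraMap C D f) (hC : C.IsConilpotent)
    (h : ∀ x : C, Coalgebra.counit (R := K) x = 0 → reducedComul C x = 0 → f x = 0 → x = 0) :
    Function.Injective f := by
  have key : ∀ r : ℕ, ∀ x : C, iteratedReducedComul C r x = 0 →
      Coalgebra.counit (R := K) x = 0 → f x = 0 → x = 0 := by
    intro r
    induction r with
    | zero =>
      intro x hx _ _
      exact (TensorAlgebra.ι_leftInverse (R := K) (M := C)).injective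
        (by simpa [iteratedReducedComul] using hx)
    | succ r ih =>
      intro x hx hx0 hfx
      obtain ⟨p, hp, hpx⟩ := exists_projection_reducedComul C r
      -- By induction `f` is injective on the range of `p`, so `p = z f p`. The reduced
      -- comultiplication of `x` is then `z ⊗ z` applied to that of `f x = 0`, so `x` is primitive.
      obtain ⟨z, hz⟩ := exists_comp_eq_of_ker_le (f ∘ₗ p) p fun y hy =>
        ih _ (hp y).1 (hp y).2 hy
      refine h x hx0 ?_ hfx
      have h1 := LinearMap.congr_fun hf.reducedComul_comp x
      rw [LinearMap.comp_apply, hfx, map_zero, LinearMap.comp_apply] at h1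
      rw [← hpx x hx]
      conv_lhs => rw [hz]
      rw [TensorProduct.map_comp, TensorProduct.map_comp, LinearMap.comp_apply,
        LinearMap.comp_apply, hpx x hx, ← h1, map_zero]
  rw [← LinearMap.ker_eq_bot, LinearMap.ker_eq_bot']
  intro x hx
  have hx0 : Coalgebra.counit (R := K) x = 0 := by
    rw [← hf.counit, LinearMap.comp_apply, hx, map_zero]
  obtain ⟨r, hr⟩ := hC x hx0
  exact key r x hr hx0 hx

/-- An injective map from a tensor coalgebra to a conilpotent coalgebra is surjective if its range
contains the primitive elements. -/
theorem IsUnitalCoalgebraMap.surjective {V : GradedSpace.{w₁} K} {C : UnitalCoalgebra.{w₂} K}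
    {f : tensorCoalgebra V →ₗ[K] C} (hf : IsUnitalCoalgebraMap (tensorCoalgebra V) C f)
    (hinj : Function.Injective f) (hC : C.IsConilpotent)
    (h : ∀ x : C, Coalgebra.counit (R := K) x = 0 → reducedComul C x = 0 →
      x ∈ LinearMap.range f) :
    Function.Surjective f := by
  obtain ⟨g, hg⟩ := LinearMap.exists_leftInverse_of_injective f (LinearMap.ker_eq_bot.2 hinj)
  have key : ∀ r : ℕ, ∀ x : C, iteratedReducedComul C r x = 0 →
      Coalgebra.counit (R := K) x = 0 → x ∈ LinearMap.range f := by
    intro r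
    induction r with
    | zero =>
      intro x hx _
      have : x = 0 := (TensorAlgebra.ι_leftInverse (R := K) (M := C)).injective
        (by simpa [iteratedReducedComul] using hx)
      simp [this]
    | succ r ih =>
      intro x hx hx0
      obtain ⟨p, hp, hpx⟩ := exists_projection_reducedComul C r
      -- By induction the range of `p` lies in the range of `f`, on which `f g` is the identity.
      -- Hence the reduced comultiplication of `x` is `f ⊗ f` of its image `t` under `g ⊗ g`.
      have hfg : (f ∘ₗ g) ∘ₗ p = p := LinearMap.ext fun y => by
        obtain ⟨z, hz⟩ := ih _ (hp y).1 (hp y).2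
        have := LinearMap.congr_fun hg z
        simp only [LinearMap.comp_apply, LinearMap.id_apply] at this ⊢
        rw [← hz, this]
      have ht : TensorProduct.map f f (TensorProduct.map g g (reducedComul C x)) =
          reducedComul C x := by
        conv_lhs => rw [← hpx x hx]
        rw [← LinearMap.comp_apply, ← LinearMap.comp_apply, ← TensorProduct.map_comp,
          ← TensorProduct.map_comp, hfg, hpx x hx]
      generalize TensorProduct.map g g (reducedComul C x) = t at ht
      have inj2 : Function.Injective (TensorProduct.map f f) :=
        Function.LeftInverse.injective (g := TensorProduct.map g g) fun s => by
          rw [← LinearMap.comp_apply, ← TensorProduct.map_comp, hg, TensorProduct.map_id,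
            LinearMap.id_apply]
      have inj3 : Function.Injective (TensorProduct.map f (TensorProduct.map f f)) :=
        Function.LeftInverse.injective (g := TensorProduct.map g (TensorProduct.map g g))
          fun s => by
            rw [← LinearMap.comp_apply, ← TensorProduct.map_comp, ← TensorProduct.map_comp, hg,
              TensorProduct.map_id, TensorProduct.map_id, LinearMap.id_apply]
      -- `c1` and `c2` hold after applying `f ⊗ f` and `f ⊗ f ⊗ f`, where they are properties of the
      -- comultiplication of `C`; injectivity pulls them back to `t`.
      have c1 : TensorProduct.map (reducedProj (tensorCoalgebra V))
          (reducedProj (tensorCoalgebra V)) t = t := by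
        apply inj2
        rw [← LinearMap.comp_apply, ← TensorProduct.map_comp, hf.comp_reducedProj,
          TensorProduct.map_comp, LinearMap.comp_apply, ht]
        exact LinearMap.congr_fun (map_reducedProj_comp_reducedComul C) x
      have c2 : TensorProduct.assoc K _ _ _
            ((reducedComul (tensorCoalgebra V)).rTensor (tensorCoalgebra V) t) =
          (reducedComul (tensorCoalgebra V)).lTensor (tensorCoalgebra V) t := by
        apply inj3
        have e1 : TensorProduct.map f (TensorProduct.map f f)
            ((reducedComul (tensorCoalgebra V)).lTensor (tensorCoalgebra V) t) =
            (reducedComul C).lTensor C (TensorProduct.map f f t) := by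
          rw [← LinearMap.comp_apply, ← LinearMap.comp_apply, LinearMap.map_comp_lTensor,
            LinearMap.lTensor_comp_map, hf.reducedComul_comp]
        have e2 : TensorProduct.map f (TensorProduct.map f f) (TensorProduct.assoc K _ _ _
            ((reducedComul (tensorCoalgebra V)).rTensor (tensorCoalgebra V) t)) =
            TensorProduct.assoc K _ _ _
              ((reducedComul C).rTensor C (TensorProduct.map f f t)) := by
          rw [TensorProduct.map_map_assoc, ← LinearMap.comp_apply _ (LinearMap.rTensor _ _),
            ← LinearMap.comp_apply (LinearMap.rTensor _ _), LinearMap.map_comp_rTensor,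
            LinearMap.rTensor_comp_map, hf.reducedComul_comp]
        rw [e1, e2, ht]
        exact LinearMap.congr_fun (reducedComul_coassoc C) x
      have hy := reducedComul_prependLetter_of_cocycle V t c1 c2
      have hy' : reducedComul C (f (prependLetter V t)) = reducedComul C x := by
        rw [← LinearMap.comp_apply, hf.reducedComul_comp, LinearMap.comp_apply, ← ht]
        exact congrArg _ hy
      -- The two elements have the same reduced comultiplication; applying `J` makes the counit of
      -- the difference vanish, so that it is primitive.
      have hz : x - reducedProj C (f (prependLetter V t)) ∈ LinearMap.range f := by
        refine h _ ?_ ?_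
        · rw [map_sub, hx0, ← LinearMap.comp_apply, counit_comp_reducedProj, LinearMap.zero_apply,
            sub_zero]
        · rw [map_sub, ← LinearMap.comp_apply _ (reducedProj C), reducedComul_comp_reducedProj,
            hy', sub_self]
      have hw : reducedProj C (f (prependLetter V t)) ∈ LinearMap.range f := by
        rw [← LinearMap.comp_apply, ← hf.comp_reducedProj]
        exact LinearMap.mem_range_self _ _
      simpa using Submodule.add_mem _ hz hw
  intro x
  have h0 : Coalgebra.counit (R := K) (reducedProj C x) = 0 :=
    LinearMap.congr_fun (counit_comp_reducedProj C) x
  obtain ⟨r, hr⟩ := hC _ h0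
  obtain ⟨y, hy⟩ := key r _ hr h0
  refine ⟨y + Coalgebra.counit (R := K) x • (tensorCoalgebra V).one, ?_⟩
  rw [map_add, map_smul, hf.one, hy, reducedProj_apply, sub_add_cancel]

end Conilpotent

/-! ### Homogeneous components -/

section Homogeneous

variable {K : Type u} [Field K]

/-- The projection of a graded vector space onto its component of degree `n`. -/
def homProj (V : GradedSpace.{w} K) (n : ℤ) : V →ₗ[K] V :=
  (V.deg n).subtype ∘ₗ DirectSum.component K ℤ (fun i => V.deg i) n ∘ₗ
    (DirectSum.decomposeLinearEquiv V.deg).toLinearMap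

theorem homProj_apply (V : GradedSpace.{w} K) (n : ℤ) (x : V) :
    homProj V n x = DirectSum.decompose V.deg x n := rfl

theorem homProj_mem (V : GradedSpace.{w} K) (n : ℤ) (x : V) : homProj V n x ∈ V.deg n :=
  (DirectSum.decompose V.deg x n).2

theorem homProj_of_mem (V : GradedSpace.{w} K) {i : ℤ} {x : V} (hx : x ∈ V.deg i) (n : ℤ) :
    homProj V n x = if i = n then x else 0 := by
  rw [homProj_apply]
  split_ifs with h
  · subst h; exact DirectSum.decompose_of_mem_same V.deg hx
  · exact DirectSum.decompose_of_mem_ne V.deg hx h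

theorem exists_sum_homProj (V : GradedSpace.{w} K) (x : V) :
    ∃ s : Finset ℤ, x = ∑ i ∈ s, homProj V i x := by
  classical
  exact ⟨_, (DirectSum.sum_support_decompose V.deg x).symm⟩

/-- Linear maps that agree on homogeneous elements are equal. -/
theorem homogeneous_hom_ext (V : GradedSpace.{w} K) {W : Type*} [AddCommGroup W] [Module K W]
    {f g : V →ₗ[K] W} (h : ∀ i, ∀ x ∈ V.deg i, f x = g x) : f = g :=
  DirectSum.decompose_lhom_ext V.deg fun i => LinearMap.ext fun x => h i x x.2

theorem HasDegree.comp_homProj {V : GradedSpace.{w₁} K} {W : GradedSpace.{w₂} K} {f : V →ₗ[K] W}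
    (hf : HasDegree V W 0 f) (n : ℤ) : f ∘ₗ homProj V n = homProj W n ∘ₗ f := by
  refine homogeneous_hom_ext V fun i x hx => ?_
  have h := hf i x hx
  rw [add_zero] at h
  rw [LinearMap.comp_apply, LinearMap.comp_apply, homProj_of_mem V hx, homProj_of_mem W h]
  split_ifs <;> simp

/-- An injective map of degree zero reflects degrees. -/
theorem HasDegree.mem_deg_of_injective {V : GradedSpace.{w₁} K} {W : GradedSpace.{w₂} K}
    {f : V →ₗ[K] W} (hf : HasDegree V W 0 f) (hinj : Function.Injective f) {n : ℤ} {x : V}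
    (hx : f x ∈ W.deg n) : x ∈ V.deg n := by
  have h := LinearMap.congr_fun (hf.comp_homProj n) x
  rw [LinearMap.comp_apply, LinearMap.comp_apply, homProj_of_mem W hx, if_pos rfl] at h
  rw [← hinj h]
  exact homProj_mem V n x

/-- The projection of `V ⊗ W` onto its component of degree `n`. -/
def tensorProj (V : GradedSpace.{w₁} K) (W : GradedSpace.{w₂} K) (n : ℤ) :
    V ⊗[K] W →ₗ[K] V ⊗[K] W :=
  TensorProduct.lift (DirectSum.toModule K ℤ (W →ₗ[K] V ⊗[K] W)
    (fun i => (TensorProduct.mk K V W).compl₂ (homProj W (n - i)) ∘ₗ (V.deg i).subtype) ∘ₗ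
    (DirectSum.decomposeLinearEquiv V.deg).toLinearMap)

theorem tensorProj_of_mem (V : GradedSpace.{w₁} K) (W : GradedSpace.{w₂} K) {i : ℤ}
    {t : V ⊗[K] W} (ht : t ∈ tensorDeg V W i) (n : ℤ) :
    tensorProj V W n t = if i = n then t else 0 := by
  induction ht using Submodule.span_induction with
  | mem t h =>
    obtain ⟨j, k, hjk, x, hx, y, hy, rfl⟩ := h
    have h := DirectSum.decompose_of_mem V.deg hx
    simp only [tensorProj, TensorProduct.lift.tmul, LinearMap.comp_apply, LinearEquiv.coe_coe,
      DirectSum.decomposeLinearEquiv_apply]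
    rw [h, ← DirectSum.lof_eq_of K, DirectSum.toModule_lof]
    simp only [LinearMap.comp_apply, LinearMap.compl₂_apply, Submodule.subtype_apply,
      TensorProduct.mk_apply, homProj_of_mem W hy]
    by_cases hn : i = n
    · rw [if_pos hn, if_pos (by omega)]
    · rw [if_neg hn, if_neg (by omega), TensorProduct.tmul_zero]
  | zero => simp
  | add x y _ _ hx hy => rw [map_add, hx, hy]; split_ifs <;> simp
  | smul a x _ hx => rw [map_smul, hx]; split_ifs <;> simp

theorem comp_homProj_of_tensorDeg {U : GradedSpace.{w} K} {V : GradedSpace.{w₁} K}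
    {W : GradedSpace.{w₂} K} {f : U →ₗ[K] V ⊗[K] W}
    (hf : ∀ i, ∀ x ∈ U.deg i, f x ∈ tensorDeg V W i) (n : ℤ) :
    f ∘ₗ homProj U n = tensorProj V W n ∘ₗ f := by
  refine homogeneous_hom_ext U fun i x hx => ?_
  rw [LinearMap.comp_apply, LinearMap.comp_apply, homProj_of_mem U hx,
    tensorProj_of_mem V W (hf i x hx)]
  split_ifs <;> simp

theorem map_mem_tensorDeg {V₁ W₁ : GradedSpace.{w₁} K} {V₂ W₂ : GradedSpace.{w₂} K}
    {f : V₁ →ₗ[K] V₂} {g : W₁ →ₗ[K] W₂} (hf : HasDegree V₁ V₂ 0 f) (hg : HasDegree W₁ W₂ 0 g)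
    {n : ℤ} {t : V₁ ⊗[K] W₁} (ht : t ∈ tensorDeg V₁ W₁ n) :
    TensorProduct.map f g t ∈ tensorDeg V₂ W₂ n := by
  induction ht using Submodule.span_induction with
  | mem t h =>
    obtain ⟨j, k, hjk, x, hx, y, hy, rfl⟩ := h
    exact Submodule.subset_span ⟨j, k, hjk, _, by simpa using hf j x hx, _,
      by simpa using hg k y hy, by simp⟩
  | zero => simp
  | add x y _ _ hx hy => rw [map_add]; exact Submodule.add_mem _ hx hy
  | smul a x _ hx => rw [map_smul]; exact Submodule.smul_mem _ _ hx

/-- The homogeneous components of an element of `P` stay in `P`, so its decomposition in `V` is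
already one in `P`. This grades the primitive elements. -/
theorem isInternal_comap_subtype (V : GradedSpace.{w} K) (P : Submodule K V)
    (hP : ∀ n, ∀ x ∈ P, homProj V n x ∈ P) :
    DirectSum.IsInternal fun n => (V.deg n).comap P.subtype := by
  refine DirectSum.isInternal_submodule_of_iSupIndep_of_iSup_eq_top (fun i => ?_) ?_
  · rw [Submodule.disjoint_def]
    intro x hx hx'
    have h : ⨆ (j) (_ : j ≠ i), (V.deg j).comap P.subtype ≤
        LinearMap.ker (homProj V i ∘ₗ P.subtype) := by
      refine iSup₂_le fun j hj y hy => ?_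
      rw [LinearMap.mem_ker, LinearMap.comp_apply, homProj_of_mem V hy, if_neg hj]
    have h' := h hx'
    rw [LinearMap.mem_ker, LinearMap.comp_apply, homProj_of_mem V hx, if_pos rfl] at h'
    exact Subtype.ext h'
  · refine eq_top_iff.2 fun x _ => ?_
    obtain ⟨s, hs⟩ := exists_sum_homProj V (x : V)
    have h : x = ∑ i ∈ s, (⟨homProj V i x, hP i x x.2⟩ : P) := by
      refine Subtype.ext ?_
      rw [AddSubmonoidClass.coe_finsetSum]
      exact hs
    rw [h]
    exact Submodule.sum_mem _ fun i _ =>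
      Submodule.mem_iSup_of_mem i (homProj_mem V i x)

end Homogeneous

/-! ### Primitive elements -/

section Primitive

variable {K : Type u} [Field K]

/-- The space of primitive elements. -/
def primitives (C : UnitalCoalgebra.{w} K) : Submodule K C :=
  LinearMap.ker (reducedComul C) ⊓ LinearMap.ker (Coalgebra.counit (R := K) (A := C))

theorem reducedProj_hasDegree (C : UnitalCoalgebra.{w} K) :
    HasDegree C.toGradedSpace C.toGradedSpace 0 (reducedProj C) := by
  intro n x hx
  rw [add_zero, reducedProj_apply]
  refine Submodule.sub_mem _ hx ?_
  by_cases hn : n = 0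
  · subst hn; exact Submodule.smul_mem _ _ C.one_mem
  · rw [C.counit_eq_zero n hn x hx, zero_smul]; exact Submodule.zero_mem _

/-- The reduced comultiplication and the counit have degree zero, so their kernels are stable under
projection to homogeneous components. -/
theorem homProj_mem_primitives (C : UnitalCoalgebra.{w} K) (n : ℤ) (x : C)
    (hx : x ∈ primitives C) : homProj C.toGradedSpace n x ∈ primitives C := by
  refine ⟨?_, ?_⟩
  · have h := LinearMap.congr_fun (comp_homProj_of_tensorDeg (f := reducedComul C)
      (fun i y hy => map_mem_tensorDeg (reducedProj_hasDegree C) (reducedProj_hasDegree C)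
        (C.comul_mem i y hy)) n) x
    rw [LinearMap.comp_apply, LinearMap.comp_apply, LinearMap.mem_ker.1 hx.1, map_zero] at h
    exact h
  · have h : Coalgebra.counit (R := K) (A := C) ∘ₗ homProj C.toGradedSpace n =
        if n = 0 then Coalgebra.counit (R := K) (A := C) else 0 := by
      refine homogeneous_hom_ext C.toGradedSpace fun i y hy => ?_
      rw [LinearMap.comp_apply, homProj_of_mem _ hy]
      have := C.counit_eq_zero i
      split_ifs with h1 h2 h2
      · rfl
      · rw [this (by omega) y hy]; rfl
      · rw [map_zero, this (by omega) y hy]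
      · simp
    have h' := LinearMap.congr_fun h x
    rw [LinearMap.comp_apply] at h'
    refine LinearMap.mem_ker.2 (h'.trans ?_)
    split_ifs
    · exact hx.2
    · rfl

/-- The graded vector space of primitive elements. -/
def primitiveSpace (C : UnitalCoalgebra.{w} K) : GradedSpace.{w} K where
  carrier := primitives C
  deg n := (C.deg n).comap (primitives C).subtype
  decomposition := (isInternal_comap_subtype C.toGradedSpace (primitives C)
    (homProj_mem_primitives C)).chooseDecomposition

/-- The inclusion of the primitive elements. -/
def primitiveIncl (C : UnitalCoalgebra.{w} K) : primitiveSpace C →ₗ[K] C :=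
  (primitives C).subtype

theorem primitiveIncl_hasDegree (C : UnitalCoalgebra.{w} K) :
    HasDegree (primitiveSpace C) C.toGradedSpace 0 (primitiveIncl C) := by
  intro n x hx
  rw [add_zero]
  exact hx

end Primitive

/-! ### Conilpotent unital infinitesimal bialgebras -/

section Infinitesimal

variable {K : Type u} [Field K]

/-- Multiplicativity of the counit is not an axiom here. Applying `ε ⊗ ε` to the compatibility of
product and comultiplication gives `ε(xy) = ε(xy) + ε(xy) - ε(x) ε(y)`. -/
theorem IsInfinitesimalBialgebra.counit_mul {C : UnitalCoalgebra.{w} K}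
    {mul : C →ₗ[K] C →ₗ[K] C} (h : IsInfinitesimalBialgebra C mul) (x y : C) :
    Coalgebra.counit (R := K) (mul x y) =
      Coalgebra.counit (R := K) x * Coalgebra.counit (R := K) y := by
  have key := congrArg (fun t => Coalgebra.counit (R := K)
    (TensorProduct.lid K C ((Coalgebra.counit (R := K) (A := C)).rTensor C t))) (h.comul_mul x y)
  have h1 := Coalgebra.rTensor_counit_comul (R := K) (mul x y)
  have h2 : (Coalgebra.counit (R := K) (A := C)).rTensor C (TensorProduct.map LinearMap.id
      (mul.flip y) (Coalgebra.comul (R := K) x)) = 1 ⊗ₜ[K] mul x y := by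
    have := Coalgebra.rTensor_counit_comul (R := K) x
    rw [← LinearMap.lTensor, ← LinearMap.comp_apply, LinearMap.rTensor_comp_lTensor,
      ← LinearMap.lTensor_comp_rTensor, LinearMap.comp_apply, this]
    simp
  have h3 : Coalgebra.counit (R := K) (TensorProduct.lid K C
      ((Coalgebra.counit (R := K) (A := C)).rTensor C (TensorProduct.map (mul x) LinearMap.id
        (Coalgebra.comul (R := K) y)))) = Coalgebra.counit (R := K) (mul x y) := by
    have e : ∀ t : C ⊗[K] C, Coalgebra.counit (R := K) (TensorProduct.lid K C
        ((Coalgebra.counit (R := K) (A := C)).rTensor C (TensorProduct.map (mul x)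
          LinearMap.id t))) = Coalgebra.counit (R := K) (mul x (TensorProduct.rid K C
            ((Coalgebra.counit (R := K) (A := C)).lTensor C t))) := by
      intro t
      induction t with
      | zero => simp
      | add a b ha hb => simp only [map_add, ha, hb]
      | tmul a b => simp [mul_comm]
    rw [e, Coalgebra.lTensor_counit_comul]
    simp
  simp only [map_add, map_sub, h1, h2, h3] at key
  simp only [LinearMap.rTensor_tmul, TensorProduct.lid_tmul, map_smul, smul_eq_mul, one_smul]
    at key
  linear_combination -key

variable {V : GradedSpace.{w₁} K} {C : UnitalCoalgebra.{w₂} K}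

/-- The map `T(V) → C`, `v₁ ⋯ v_k ↦ f(v₁) ∘ ⋯ ∘ f(v_k)` for a product `∘` on `C`. -/
def wordMap (mul : C →ₗ[K] C →ₗ[K] C) (f : V →ₗ[K] C) : tensorCoalgebra V →ₗ[K] C :=
  LinearMap.applyₗ C.one ∘ₗ
    (TensorAlgebra.lift K (mul ∘ₗ f : V →ₗ[K] Module.End K C)).toLinearMap

variable (mul : C →ₗ[K] C →ₗ[K] C) (f : V →ₗ[K] C)

theorem wordMap_one : wordMap mul f (1 : TensorAlgebra K V) = C.one := by
  simp [wordMap]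

theorem wordMap_ι_mul (v : V) (x : TensorAlgebra K V) :
    wordMap mul f (TensorAlgebra.ι K v * x) = mul (f v) (wordMap mul f x) := by
  simp [wordMap]

variable {mul}

theorem wordMap_ι (h : IsAlgebra C mul) (v : V) :
    wordMap mul f (TensorAlgebra.ι K v) = f v := by
  rw [← mul_one (TensorAlgebra.ι K v), wordMap_ι_mul, wordMap_one, h.mul_one]

theorem wordMap_mul (h : IsAlgebra C mul) (x y : TensorAlgebra K V) :
    wordMap mul f (x * y) = mul (wordMap mul f x) (wordMap mul f y) := by
  induction x using word_induction with
  | one => rw [one_mul, wordMap_one, h.one_mul]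
  | cons v x hx => rw [mul_assoc, wordMap_ι_mul, hx, wordMap_ι_mul, h.mul_assoc]
  | add a b ha hb => rw [add_mul, map_add, ha, hb, map_add, map_add, LinearMap.add_apply]
  | smul c a ha => rw [smul_mul_assoc, map_smul, ha, map_smul, map_smul, LinearMap.smul_apply]

variable {f}

/-- If `C` is a unital infinitesimal bialgebra, a map from `V` to the primitive elements of `C`
extends to a map of coalgebras `T^c(V) → C`. -/
theorem wordMap_isUnitalCoalgebraMap (h : IsInfinitesimalBialgebra C mul)
    (hf : HasDegree V C.toGradedSpace 0 f) (hp : ∀ v, f v ∈ primitives C) :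
    IsUnitalCoalgebraMap (tensorCoalgebra V) C (wordMap mul f) where
  degree n x hx := by
    rw [add_zero]
    change x ∈ wordDeg V n at hx
    induction hx using Submodule.span_induction with
    | mem x hx =>
      obtain ⟨l, hl, rfl⟩ := hx
      induction l generalizing n with
      | nil =>
        simp only [List.map_nil, List.sum_nil, List.prod_nil] at hl ⊢
        subst hl
        rw [wordMap_one]
        exact C.one_mem
      | cons p l ih =>
        simp only [List.map_cons, List.sum_cons, List.prod_cons] at hl ⊢
        rw [wordMap_ι_mul, ← hl]
        exact h.mul_mem _ _ _ (by simpa using hf _ _ p.2.2) _ (ih _ rfl)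
    | zero => rw [map_zero]; exact Submodule.zero_mem _
    | add x y _ _ hx hy => rw [map_add]; exact Submodule.add_mem _ hx hy
    | smul a x _ hx => rw [map_smul]; exact Submodule.smul_mem _ _ hx
  comul := by
    refine LinearMap.ext fun x => ?_
    change Coalgebra.comul (R := K) (wordMap mul f x) =
      TensorProduct.map (wordMap mul f) (wordMap mul f) (deconc V x)
    change TensorAlgebra K V at x
    induction x using word_induction with
    | one => rw [wordMap_one, C.comul_one, deconc_one, TensorProduct.map_tmul, wordMap_one]
    | cons v x hx =>
      -- For a primitive left factor the correction `-x ⊗ y` in the infinitesimal relation cancels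
      -- one of the terms, and what remains is the recursion of deconcatenation.
      have hv : Coalgebra.comul (R := K) (f v) = f v ⊗ₜ[K] C.one + C.one ⊗ₜ[K] f v := by
        have := reducedComul_apply C (f v) (hp v).2
        rw [LinearMap.mem_ker.1 (hp v).1, eq_comm, sub_sub, sub_eq_zero] at this
        exact this
      have e : wordMap mul f ∘ₗ LinearMap.mulLeft K (TensorAlgebra.ι K v) =
          mul (f v) ∘ₗ wordMap mul f := LinearMap.ext fun y => wordMap_ι_mul mul f v y
      rw [wordMap_ι_mul, h.comul_mul, hx, hv, deconc_ι_mul, map_add, map_add, tensor_mul_left]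
      have e2 : TensorProduct.map (wordMap mul f) (wordMap mul f)
          ((LinearMap.mulLeft K (TensorAlgebra.ι K v)).rTensor _ (deconc V x)) =
          TensorProduct.map (mul (f v)) LinearMap.id
            (TensorProduct.map (wordMap mul f) (wordMap mul f) (deconc V x)) := by
        generalize deconc V x = t
        rw [← LinearMap.comp_apply, ← LinearMap.comp_apply, LinearMap.map_comp_rTensor,
          ← TensorProduct.map_comp, LinearMap.id_comp]
        exact congrArg (fun g => TensorProduct.map g (wordMap mul f) t) e
      have e3 : TensorProduct.map (wordMap mul f) (wordMap mul f)
          ((1 : TensorAlgebra K V) ⊗ₜ[K] (TensorAlgebra.ι K v * x)) =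
          C.one ⊗ₜ[K] mul (f v) (wordMap mul f x) := by
        rw [TensorProduct.map_tmul, wordMap_one, wordMap_ι_mul]
      rw [e2, e3]
      simp only [TensorProduct.map_tmul, LinearMap.id_apply, LinearMap.flip_apply,
        h.one_mul]
      abel
    | add a b ha hb => simp only [map_add, ha, hb]
    | smul c a ha => simp only [map_smul, ha]
  counit := by
    refine LinearMap.ext fun x => ?_
    change Coalgebra.counit (R := K) (wordMap mul f x) = wordCounit V x
    change TensorAlgebra K V at x
    induction x using word_induction with
    | one => rw [wordMap_one, C.counit_one, wordCounit_one]
    | cons v x hx =>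
      rw [wordMap_ι_mul, h.counit_mul, LinearMap.mem_ker.1 (hp v).2, zero_mul, wordCounit_ι_mul]
    | add a b ha hb => simp only [map_add, ha, hb]
    | smul c a ha => simp only [map_smul, ha]
  one := wordMap_one mul f

/-- A conilpotent unital infinitesimal bialgebra is isomorphic to the tensor coalgebra on its
primitive elements, with concatenation as its product. -/
theorem wordMap_primitiveIncl_bijective (h : IsInfinitesimalBialgebra C mul)
    (hC : C.IsConilpotent) : Function.Bijective (wordMap mul (primitiveIncl C)) := by
  have hm := wordMap_isUnitalCoalgebraMap h (primitiveIncl_hasDegree C) fun v => v.2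
  -- On letters, which are the primitives of the source, the map is the inclusion of the primitives
  -- of `C`. This gives injectivity, and also the range condition for surjectivity.
  have hinj : Function.Injective (wordMap mul (primitiveIncl C)) := by
    refine hm.injective (tensorCoalgebra_isConilpotent _) fun x hx0 hx hfx => ?_
    have hx' := eq_ι_ιInv_of_reducedComul_eq_zero (primitiveSpace C) hx0 hx
    rw [hx', wordMap_ι _ h.toIsAlgebra] at hfx
    rw [hx', (Subtype.ext hfx : TensorAlgebra.ιInv (R := K) (M := primitiveSpace C) x = 0)]
    exact map_zero _
  refine ⟨hinj, hm.surjective hinj hC fun x hx0 hx => ⟨TensorAlgebra.ι K ?_, ?_⟩⟩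
  · exact (⟨x, hx, hx0⟩ : primitives C)
  · exact wordMap_ι _ h.toIsAlgebra _

end Infinitesimal

/-! ### Transport of structure -/

section Transport

variable {K : Type u} [Field K]

/-- Maps of degree zero preserve parity, so all Koszul signs are natural for them. -/
theorem HasDegree.comp_oddPart {V : GradedSpace.{w₁} K} {W : GradedSpace.{w₂} K} {f : V →ₗ[K] W}
    (hf : HasDegree V W 0 f) : f ∘ₗ oddPart V = oddPart W ∘ₗ f := by
  refine homogeneous_hom_ext V fun i x hx => ?_
  have h := hf i x hx
  rw [add_zero] at h
  rw [LinearMap.comp_apply, LinearMap.comp_apply, oddPart_apply V hx, oddPart_apply W h]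
  split_ifs <;> simp

theorem HasDegree.comp_signMap {V : GradedSpace.{w₁} K} {W : GradedSpace.{w₂} K} {f : V →ₗ[K] W}
    (hf : HasDegree V W 0 f) : f ∘ₗ signMap V = signMap W ∘ₗ f := by
  rw [signMap, signMap, LinearMap.comp_sub, LinearMap.comp_smul, hf.comp_oddPart,
    LinearMap.sub_comp, LinearMap.smul_comp, LinearMap.comp_id, LinearMap.id_comp]

/-- Only the two middle maps need a degree, since the sign depends on the two interchanged factors
alone. -/
theorem middleSwap_comp_map {A₁ B₁ C₁ D₁ : GradedSpace.{w₁} K} {A₂ B₂ C₂ D₂ : GradedSpace.{w₂} K}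
    (f : A₁ →ₗ[K] A₂) {g : B₁ →ₗ[K] B₂} {h : C₁ →ₗ[K] C₂} (k : D₁ →ₗ[K] D₂)
    (hg : HasDegree B₁ B₂ 0 g) (hh : HasDegree C₁ C₂ 0 h) :
    middleSwap A₂ B₂ C₂ D₂ ∘ₗ TensorProduct.map (TensorProduct.map f g) (TensorProduct.map h k) =
      TensorProduct.map (TensorProduct.map f h) (TensorProduct.map g k) ∘ₗ
        middleSwap A₁ B₁ C₁ D₁ := by
  have e1 : ∀ b, g (oddPart B₁ b) = oddPart B₂ (g b) := LinearMap.congr_fun hg.comp_oddPart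
  have e2 : ∀ c, h (oddPart C₁ c) = oddPart C₂ (h c) := LinearMap.congr_fun hh.comp_oddPart
  refine TensorProduct.ext_fourfold' fun a b c d => ?_
  simp [middleSwap, e1, e2]

theorem IsUnitalCoalgebraMap.symm {C : UnitalCoalgebra.{w₁} K} {D : UnitalCoalgebra.{w₂} K}
    {e : C ≃ₗ[K] D} (he : IsUnitalCoalgebraMap C D e.toLinearMap) :
    IsUnitalCoalgebraMap D C e.symm.toLinearMap where
  degree n x hx := by
    rw [add_zero]
    refine he.degree.mem_deg_of_injective e.injective ?_
    simpa using hx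
  comul := by
    have h := congrArg (fun f => TensorProduct.map e.symm.toLinearMap e.symm.toLinearMap ∘ₗ
      f ∘ₗ e.symm.toLinearMap) he.comul
    simp only [LinearMap.comp_assoc, LinearEquiv.comp_symm, LinearMap.comp_id] at h
    rw [h, ← LinearMap.comp_assoc, ← TensorProduct.map_comp, LinearEquiv.symm_comp,
      TensorProduct.map_id, LinearMap.id_comp]
  counit := by
    rw [← he.counit, LinearMap.comp_assoc, LinearEquiv.comp_symm, LinearMap.comp_id]
  one := by
    rw [← he.one]
    exact e.symm_apply_apply _

/-- Transport of a product along a linear isomorphism. -/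
def transportMul {C : UnitalCoalgebra.{w₁} K} {D : UnitalCoalgebra.{w₂} K} (e : C ≃ₗ[K] D)
    (mul : D →ₗ[K] D →ₗ[K] D) : C →ₗ[K] C →ₗ[K] C :=
  (mul.compl₁₂ e.toLinearMap e.toLinearMap).compr₂ e.symm.toLinearMap

theorem transportMul_apply {C : UnitalCoalgebra.{w₁} K} {D : UnitalCoalgebra.{w₂} K}
    (e : C ≃ₗ[K] D) (mul : D →ₗ[K] D →ₗ[K] D) (x y : C) :
    transportMul e mul x y = e.symm (mul (e x) (e y)) := rfl

theorem lift_transportMul {C : UnitalCoalgebra.{w₁} K} {D : UnitalCoalgebra.{w₂} K}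
    (e : C ≃ₗ[K] D) (mul : D →ₗ[K] D →ₗ[K] D) :
    TensorProduct.lift (transportMul e mul) = e.symm.toLinearMap ∘ₗ TensorProduct.lift mul ∘ₗ
      TensorProduct.map e.toLinearMap e.toLinearMap :=
  TensorProduct.ext' fun _ _ => rfl

/-- Every axiom equates maps composed of the structure maps, the Koszul symmetry and the sign map.
All of these are intertwined by `e`, so the axioms survive conjugation. -/
theorem IsDGBialgebra.transport {C : UnitalCoalgebra.{w₁} K} {D : UnitalCoalgebra.{w₂} K}
    {e : C ≃ₗ[K] D} (he : IsUnitalCoalgebraMap C D e.toLinearMap) {mul : D →ₗ[K] D →ₗ[K] D}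
    {d : D →ₗ[K] D} (h : IsDGBialgebra D mul d) :
    IsDGBialgebra C (transportMul e mul) (e.symm.toLinearMap ∘ₗ d ∘ₗ e.toLinearMap) := by
  have hdeg : ∀ {n x}, x ∈ C.deg n → e x ∈ D.deg n := fun {n x} hx => by
    simpa using he.degree n x hx
  have hdeg' : ∀ {n x}, x ∈ D.deg n → e.symm x ∈ C.deg n := fun {n x} hx => by
    simpa using he.symm.degree n x hx
  have hone : e C.one = D.one := he.one
  have hone' : e.symm D.one = C.one := he.symm.one
  -- Naturality of the differential on the tensor square, used both for the derivation and for the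
  -- coderivation property.
  have hds : (TensorProduct.map d LinearMap.id + TensorProduct.map (signMap D.toGradedSpace) d) ∘ₗ
      TensorProduct.map e.toLinearMap e.toLinearMap =
      TensorProduct.map e.toLinearMap e.toLinearMap ∘ₗ
        (TensorProduct.map (e.symm.toLinearMap ∘ₗ d ∘ₗ e.toLinearMap) LinearMap.id +
          TensorProduct.map (signMap C.toGradedSpace)
            (e.symm.toLinearMap ∘ₗ d ∘ₗ e.toLinearMap)) := by
    rw [LinearMap.add_comp, LinearMap.comp_add, ← TensorProduct.map_comp,
      ← TensorProduct.map_comp, ← TensorProduct.map_comp, ← TensorProduct.map_comp,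
      he.degree.comp_signMap, ← LinearMap.comp_assoc _ e.symm.toLinearMap, LinearEquiv.comp_symm]
    rfl
  exact {
    mul_mem := fun i j x hx y hy => hdeg' (h.mul_mem i j _ (hdeg hx) _ (hdeg hy))
    mul_assoc := fun x y z => by simp [transportMul_apply, h.mul_assoc]
    one_mul := fun x => by simp [transportMul_apply, hone, h.one_mul]
    mul_one := fun x => by simp [transportMul_apply, hone, h.mul_one]
    comul_mul := by
      rw [lift_transportMul, ← LinearMap.comp_assoc, he.symm.comul, LinearMap.comp_assoc,
        ← LinearMap.comp_assoc _ _ Coalgebra.comul, h.comul_mul, LinearMap.comp_assoc,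
        LinearMap.comp_assoc, ← TensorProduct.map_comp, he.comul, TensorProduct.map_comp,
        ← LinearMap.comp_assoc _ _ (middleSwap _ _ _ _),
        middleSwap_comp_map _ _ he.degree he.degree]
      simp only [TensorProduct.map_comp, LinearMap.comp_assoc]
    counit_mul := fun x y => by
      have h1 := LinearMap.congr_fun he.symm.counit (mul (e x) (e y))
      have h2 := LinearMap.congr_fun he.counit x
      have h3 := LinearMap.congr_fun he.counit y
      simp only [LinearMap.comp_apply, LinearEquiv.coe_coe] at h1 h2 h3
      rw [transportMul_apply, h1, h.counit_mul, h2, h3]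
    d_degree := fun n x hx => hdeg' (h.d_degree n _ (hdeg hx))
    d_one := by simp [hone, h.d_one]
    d_comp_d := by
      ext x
      have := LinearMap.congr_fun h.d_comp_d (e x)
      rw [LinearMap.comp_apply] at this
      simp [this]
    d_mul := by
      have h1 : (e.symm.toLinearMap ∘ₗ d ∘ₗ e.toLinearMap) ∘ₗ
          e.symm.toLinearMap ∘ₗ TensorProduct.lift mul ∘ₗ
            TensorProduct.map e.toLinearMap e.toLinearMap =
          e.symm.toLinearMap ∘ₗ (d ∘ₗ TensorProduct.lift mul) ∘ₗ
            TensorProduct.map e.toLinearMap e.toLinearMap := by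
        refine LinearMap.ext fun t => ?_
        simp
      rw [lift_transportMul, h1, h.d_mul, LinearMap.comp_assoc, hds]
      simp only [LinearMap.comp_assoc]
    comul_d := by
      rw [← LinearMap.comp_assoc, he.symm.comul, LinearMap.comp_assoc,
        ← LinearMap.comp_assoc _ _ Coalgebra.comul, h.comul_d, LinearMap.comp_assoc, he.comul,
        ← LinearMap.comp_assoc _ (TensorProduct.map _ _) (_ + _), hds, ← LinearMap.comp_assoc,
        ← LinearMap.comp_assoc, ← TensorProduct.map_comp, LinearEquiv.symm_comp,
        TensorProduct.map_id, LinearMap.id_comp] }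

end Transport

/-! ### The equivalences -/

section Equivalence

variable {K : Type u} [Field K]

theorem UnitalCoalgebra.IsCofree.isConilpotent {C : UnitalCoalgebra.{w} K} (h : C.IsCofree) :
    C.IsConilpotent := by
  obtain ⟨V, e, he⟩ := h
  exact UnitalCoalgebra.IsConilpotent.of_injective he e.injective (tensorCoalgebra_isConilpotent V)

/-- The isomorphism of a conilpotent unital infinitesimal bialgebra with the tensor coalgebra on its
primitive elements. -/
def primitiveEquiv {C : UnitalCoalgebra.{w} K} {mul : C →ₗ[K] C →ₗ[K] C}
    (h : IsInfinitesimalBialgebra C mul) (hC : C.IsConilpotent) :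
    tensorCoalgebra (primitiveSpace C) ≃ₗ[K] C :=
  LinearEquiv.ofBijective _ (wordMap_primitiveIncl_bijective h hC)

theorem primitiveEquiv_isUnitalCoalgebraMap {C : UnitalCoalgebra.{w} K}
    {mul : C →ₗ[K] C →ₗ[K] C} (h : IsInfinitesimalBialgebra C mul) (hC : C.IsConilpotent) :
    IsUnitalCoalgebraMap (tensorCoalgebra (primitiveSpace C)) C
      (primitiveEquiv h hC).toLinearMap :=
  wordMap_isUnitalCoalgebraMap h (primitiveIncl_hasDegree C) fun v => v.2

theorem primitiveEquiv_mul {C : UnitalCoalgebra.{w} K} {mul : C →ₗ[K] C →ₗ[K] C}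
    (h : IsInfinitesimalBialgebra C mul) (hC : C.IsConilpotent)
    (x y : tensorCoalgebra (primitiveSpace C)) :
    primitiveEquiv h hC (concat _ x y) = mul (primitiveEquiv h hC x) (primitiveEquiv h hC y) :=
  wordMap_mul _ h.toIsAlgebra x y

/-- The product of the infinitesimal bialgebra is what extends primitives to words; the other
product and the differential play no role. -/
theorem IsInfinitesimalBialgebra.isCofree {C : UnitalCoalgebra.{max u v} K}
    {mul : C →ₗ[K] C →ₗ[K] C} (h : IsInfinitesimalBialgebra C mul) (hC : C.IsConilpotent) :
    C.IsCofree :=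
  ⟨primitiveSpace C, (primitiveEquiv h hC).symm,
    (primitiveEquiv_isUnitalCoalgebraMap h hC).symm⟩

/-- A bijective homomorphism of 2-associative differential bialgebras is an isomorphism. -/
def TwoAssBialgebra.isoOfLinearEquiv {V W : TwoAssBialgebra.{w} K}
    (e : V.toUnitalCoalgebra ≃ₗ[K] W.toUnitalCoalgebra)
    (he : IsUnitalCoalgebraMap V.toUnitalCoalgebra W.toUnitalCoalgebra e.toLinearMap)
    (map_mul : ∀ x y, e (V.mul x y) = W.mul (e x) (e y)) (map_d : ∀ x, e (V.d x) = W.d (e x))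
    (map_circ : ∀ x y, e (V.circ x y) = W.circ (e x) (e y)) : V ≅ W where
  hom := TwoAssBialgebra.Hom.mk e.toLinearMap he map_mul map_d map_circ
  inv := TwoAssBialgebra.Hom.mk e.symm.toLinearMap he.symm
    (fun x y => e.injective (by simp [map_mul])) (fun x => e.injective (by simp [map_d]))
    (fun x y => e.injective (by simp [map_circ]))
  hom_inv_id := TwoAssBialgebra.Hom.ext (LinearEquiv.symm_comp e)
  inv_hom_id := TwoAssBialgebra.Hom.ext (LinearEquiv.comp_symm e)

/-- The `B_∞` algebra of primitive elements of a conilpotent 2-associative differential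
bialgebra. -/
def primitiveBInf (V : TwoAssBialgebra.{max u v} K) (hV : V.toUnitalCoalgebra.IsConilpotent) :
    BInfAlgebra.{max u v} K where
  toGradedSpace := primitiveSpace V.toUnitalCoalgebra
  mul := transportMul (primitiveEquiv V.isInfinitesimalBialgebra hV) V.mul
  d := (primitiveEquiv V.isInfinitesimalBialgebra hV).symm.toLinearMap ∘ₗ V.d ∘ₗ
    (primitiveEquiv V.isInfinitesimalBialgebra hV).toLinearMap
  isDGBialgebra := V.isDGBialgebra.transport (primitiveEquiv_isUnitalCoalgebraMap _ _)

/-- A conilpotent 2-associative differential bialgebra is the universal envelope of its primitive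
elements. -/
def envelopePrimitiveIso (V : TwoAssBialgebra.{max u v} K)
    (hV : V.toUnitalCoalgebra.IsConilpotent) :
    (envelope.{u, v} K).obj (primitiveBInf.{u, v} V hV) ≅ V :=
  TwoAssBialgebra.isoOfLinearEquiv (V := (envelope.{u, v} K).obj (primitiveBInf.{u, v} V hV))
    (primitiveEquiv V.isInfinitesimalBialgebra hV) (primitiveEquiv_isUnitalCoalgebraMap _ _)
    (fun _ _ => LinearEquiv.apply_symm_apply _ _) (fun _ => LinearEquiv.apply_symm_apply _ _)
    (fun x y => primitiveEquiv_mul _ _ x y)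

theorem tensorMap_ι {V W : GradedSpace.{w} K} (f : V →ₗ[K] W) (v : V) :
    tensorMap f (TensorAlgebra.ι K v) = TensorAlgebra.ι K (f v) := by
  simp [tensorMap]

/-- On words of length one `T(f)` is `f`. -/
instance envelope_faithful : (envelope.{u, v} K).Faithful where
  map_injective {A B f g} h := by
    refine BInfAlgebra.Hom.ext (LinearMap.ext fun x => ?_)
    have h' := congrArg (fun F : TwoAssBialgebra.Hom _ _ => F.toLinearMap) h
    have := LinearMap.congr_fun h' (TensorAlgebra.ι K x)
    refine (TensorAlgebra.ι_leftInverse (R := K) (M := B.toGradedSpace)).injective ?_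
    rw [← tensorMap_ι, ← tensorMap_ι]
    exact this

theorem ι_hasDegree (V : GradedSpace.{w} K) :
    HasDegree V (tensorSpace V) 0 (TensorAlgebra.ι K) := by
  intro n x hx
  rw [add_zero]
  exact ι_mem_wordDeg V hx

/-- A coalgebra map between tensor coalgebras that respects concatenation is induced by a map of
degree zero. -/
theorem exists_eq_tensorMap {V W : GradedSpace.{w} K}
    {F : tensorCoalgebra V →ₗ[K] tensorCoalgebra W}
    (hF : IsUnitalCoalgebraMap (tensorCoalgebra V) (tensorCoalgebra W) F)
    (hmul : ∀ x y, F (concat V x y) = concat W (F x) (F y)) :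
    ∃ f : V →ₗ[K] W, HasDegree V W 0 f ∧ F = tensorMap f := by
  -- Letters are primitive, `F` preserves primitives, and the primitives of the target are letters.
  have hι : ∀ v : V, F (TensorAlgebra.ι K v) =
      TensorAlgebra.ι K (TensorAlgebra.ιInv (F (TensorAlgebra.ι K v))) := fun v => by
    refine eq_ι_ιInv_of_reducedComul_eq_zero W ?_ ?_
    · exact (LinearMap.congr_fun hF.counit (TensorAlgebra.ι K v)).trans (wordCounit_ι v)
    · refine (LinearMap.congr_fun hF.reducedComul_comp (TensorAlgebra.ι K v)).trans ?_
      rw [LinearMap.comp_apply, reducedComul_ι, map_zero]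
  refine ⟨TensorAlgebra.ιInv ∘ₗ F ∘ₗ TensorAlgebra.ι K, fun n x hx => ?_, LinearMap.ext fun x => ?_⟩
  -- The degree is read off in the tensor algebra, since the inclusion of letters reflects degrees.
  · refine (ι_hasDegree W).mem_deg_of_injective
      (TensorAlgebra.ι_leftInverse (R := K) (M := W)).injective ?_
    change TensorAlgebra.ι K (TensorAlgebra.ιInv (F (TensorAlgebra.ι K x))) ∈ _
    rw [← hι]
    exact hF.degree n _ (ι_mem_wordDeg V hx)
  · change TensorAlgebra K V at x
    change F x = TensorAlgebra.lift K _ x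
    induction x using word_induction with
    | one => exact hF.one.trans (map_one (TensorAlgebra.lift K _)).symm
    | cons v x hx =>
      refine (hmul (TensorAlgebra.ι K v) x).trans ?_
      rw [map_mul (TensorAlgebra.lift K _), ← hx, TensorAlgebra.lift_ι_apply, hι v]
      rfl
    | add a b ha hb => rw [map_add, map_add, ha, hb]
    | smul c a ha => rw [map_smul, map_smul, ha]

instance envelope_full : (envelope.{u, v} K).Full where
  map_surjective {A B} F := by
    obtain ⟨f, hf, hFf⟩ := exists_eq_tensorMap F.isUnitalCoalgebraMap F.map_circ
    refine ⟨BInfAlgebra.Hom.mk f hf (fun x y => ?_) (fun x => ?_),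
      TwoAssBialgebra.Hom.ext hFf.symm⟩
    · rw [← hFf]; exact F.map_mul x y
    · rw [← hFf]; exact F.map_d x

/-- Serves the conilpotent and the cofree objects at once. Fullness and faithfulness pass to the
lift, so only essential surjectivity is left, and it needs nothing but conilpotence. -/
theorem envelope_lift_isEquivalence (P : ObjectProperty (TwoAssBialgebra.{max u v} K))
    (h : ∀ A, P ((envelope.{u, v} K).obj A)) (hP : P ≤ conilpotent K) :
    (P.lift (envelope.{u, v} K) h).IsEquivalence where
  essSurj :=
    ⟨fun V => ⟨primitiveBInf.{u, v} V.obj (hP _ V.property),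
      ⟨P.isoMk (envelopePrimitiveIso V.obj (hP _ V.property))⟩⟩⟩

end Equivalence

end BInfinity

end

theorem corollary3p3p4 (K : Type u) [Field K] :
    (∃ h : ∀ A, BInfinity.conilpotent K ((BInfinity.envelope.{u, v} K).obj A),
      ((BInfinity.conilpotent K).lift (BInfinity.envelope.{u, v} K) h).IsEquivalence) ∧
    (∃ h : ∀ A, BInfinity.cofree K ((BInfinity.envelope.{u, v} K).obj A),
      ((BInfinity.cofree K).lift (BInfinity.envelope.{u, v} K) h).IsEquivalence) ∧
    (∃ h : ∀ V : BInfinity.TwoAssBialgebra.{max u v} K,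
        BInfinity.conilpotent K V → BInfinity.cofree K V,
      (ObjectProperty.ιOfLE h).IsEquivalence) := by
  have hle : ∀ V : BInfinity.TwoAssBialgebra.{max u v} K,
      BInfinity.conilpotent K V → BInfinity.cofree K V := fun V hV =>
    BInfinity.IsInfinitesimalBialgebra.isCofree.{u, v} V.isInfinitesimalBialgebra hV
  have hge : ∀ V : BInfinity.TwoAssBialgebra.{max u v} K,
      BInfinity.cofree K V → BInfinity.conilpotent K V := fun V hV =>
    BInfinity.UnitalCoalgebra.IsCofree.isConilpotent hV
  have hconil : ∀ A, BInfinity.conilpotent K ((BInfinity.envelope.{u, v} K).obj A) := fun A =>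
    BInfinity.tensorCoalgebra_isConilpotent A.toGradedSpace
  refine ⟨⟨hconil, BInfinity.envelope_lift_isEquivalence _ _ le_rfl⟩,
    ⟨fun A => hle _ (hconil A), BInfinity.envelope_lift_isEquivalence _ _ hge⟩, hle, ?_⟩
  -- The inclusion is fully faithful, and each cofree object, being conilpotent, is its own
  -- preimage.
  exact { essSurj := ⟨fun V => ⟨⟨V.obj, hge _ V.property⟩,
    ⟨ObjectProperty.isoMk _ (Iso.refl V.obj)⟩⟩⟩ }
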